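/- **Setting.** Let $\mathcal P$ be a Polish space and let $(\mathcal R_x)_{x\in\mathcal P}$ be a Markov kernel on $\mathcal P$, i.e. a (measurable) family of non-negative Borel measures with $\mathcal R_x(\mathcal P)=1$ for all $x$. Given a finite nonzero Borel measure $\mathcal M_0$ on $\mathcal P$, the *measure-valued Pólya process* (MVPP) $(\mathcal M_n)_{n\ge 0}$ is the Markov chain started at $\mathcal M_0$ with, for all $n\ge 0$, $\mathcal M_{n+1}=\mathcal M_n+\mathcal R_{C_n}$, where, conditionally on $\mathcal M_0,\dots,\mathcal M_n$, the colour $C_n$ has law $\mathcal M_n/\mathcal M_n(\mathcal P)$. Subtraction and division on $\mathcal P$ are understood as follows. Let $B$ be an abelian group acting on $\mathcal P$ by translations $(b,x)\mapsto x+b$, and $K$ a commutative multiplicative monoid of scalars acting on $\mathcal P$ by $(k,x)\mapsto kx$ and on $B$ by group endomorphisms, such that $k(x+b)=kx+kb$; $B$ and $K$ carry separable metrizable topologies for which both actions on $\mathcal P$ are jointly continuous. (Main examples: $\mathcal P=B$ a separable Banach space over $K=\mathbb R$ or $\mathbb C$; or $\mathcal P$ any Polish space without algebraic structure, with $B=\{0\}$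 and $K=\{1\}$ acting trivially.) Write $x-b:=x+(-b)$. For $b\in B$, $a$ an invertible element of $K$ and a finite measure $\mu$ on $\mathcal P$, let $\Theta_{a,b}(\mu)$ be the image of $\mu$ under $x\mapsto a^{-1}(x-b)$. Let $a(t)$ and $b(t)$ be functions of $t$ real, where $a(t)\in K$ is invertible and $b(t)\in B$ (sequences $(a(n),b(n))_{n\ge 0}$ indexed by integers are included, through $a(t)=a(\lfloor t\rfloor)$, $b(t)=b(\lfloor t\rfloor)$). The kernel $\mathcal R$ is called *$(a(n),b(n))_{n\ge0}$-ergodic with limit $\gamma$*, where $\gamma$ is a probability measure on $\mathcal P$, if for every initial distribution the Markov chain $(W_n)_{n\ge0}$ with transition kernel $(x,A)\mapsto\mathcal R_x(A)$ satisfies $a(n)^{-1}(W_n-b(n))\to\gamma$ in distribution. **Theorem.** Assume that (a) the kernel $\mathcal R$ is $(a(n),b(n))_{n\ge 0}$-ergodic with limit $\gamma$; (b) there are measurable functions $f:\mathbb R\to B$ and $g:\mathbb R\to K$ such that, for Lebesgue-almost every $x\in\mathbb R$ and for every real function $\varepsilon$ with $\varepsilon(t)=o(\sqrt t)$, as $t\to\infty$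 along the reals, $$\frac{b(\lfloor t+x\sqrt t+\varepsilon(t)\rfloor)-b(t)}{a(t)}\to f(x)\qquad\text{and}\qquad \frac{a(\lfloor t+x\sqrt t+\varepsilon(t)\rfloor)}{a(t)}\to g(x).$$ Then, for every finite nonzero measure $\mathcal M_0$ on $\mathcal P$, the MVPP started at $\mathcal M_0$ satisfies $$\Theta_{a(\log n),\,b(\log n)}\left(n^{-1}\mathcal M_n\right)\longrightarrow \nu\quad\text{in probability as } n\to\infty,$$ for the topology of weak convergence on the space of finite measures on $\mathcal P$, where $\nu$ is the law of $\Gamma g(\Lambda)+f(\Lambda)$ with $\Gamma\sim\gamma$ and $\Lambda\sim\mathcal N(0,1)$ independent. -/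

import Mathlib

open MeasureTheory ProbabilityTheory Filter Topology Set
open scoped NNReal ENNReal Asymptotics

noncomputable section

namespace MVPP

section Urn

variable {P : Type*} [MeasurableSpace P]

/-- `Nor μ`, the probability distribution proportional to the (nonzero) finite measure `μ`. -/
def nor (μ : FiniteMeasure P) : Measure P :=
  ((μ : Measure P) univ)⁻¹ • (μ : Measure P)

/-- The replacement measure `R x`, seen as a finite measure. -/
def replacement (R : Kernel P P) [IsMarkovKernel R] (x : P) : FiniteMeasure P :=
  ⟨R x, inferInstance⟩

/-- The law of the next composition of an urn whose current composition is `μ`: the law of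
`μ + R c`, where the colour `c` is drawn according to `Nor μ`. -/
def stepLaw (R : Kernel P P) [IsMarkovKernel R] (μ : FiniteMeasure P) :
    Measure (FiniteMeasure P) :=
  (nor μ).map (fun c => μ + replacement R c)

/-- `M` is an `(M₀, R)`-measure-valued Pólya process on the probability space `(Ω, Pr)`: it starts
from `M₀`, and it is a Markov chain for its own filtration, where the conditional law of `M (n+1)`
given `M 0, …, M n` is `stepLaw R (M n)`. -/
structure IsMVPP {Ω : Type*} [MeasurableSpace Ω] (Pr : Measure Ω)
    (M₀ : FiniteMeasure P) (R : Kernel P P) [IsMarkovKernel R]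
    (M : ℕ → Ω → FiniteMeasure P) : Prop where
  measurable : ∀ n, Measurable (M n)
  initial : ∀ᵐ ω ∂Pr, M 0 ω = M₀
  step : ∀ (n : ℕ) (D : Set (Finset.Iic n → FiniteMeasure P)) (A : Set (FiniteMeasure P)),
    MeasurableSet D → MeasurableSet A →
    Pr {ω | (fun i : Finset.Iic n => M i ω) ∈ D ∧ M (n + 1) ω ∈ A} =
      ∫⁻ ω in {ω | (fun i : Finset.Iic n => M i ω) ∈ D}, stepLaw R (M n ω) A ∂Pr

/-- The law at time `n` of the Markov chain with kernel `R` and initial distribution `μ₀`. -/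
def chainLaw (R : Kernel P P) [IsMarkovKernel R] (μ₀ : ProbabilityMeasure P) :
    ℕ → ProbabilityMeasure P
  | 0 => μ₀
  | n + 1 => ⟨R ∘ₘ (chainLaw R μ₀ n : Measure P), inferInstance⟩

end Urn

section Normalisation

variable {P B K : Type*} [MeasurableSpace P] [AddCommGroup B] [AddAction B P]
  [CommMonoid K] [MulAction K P]

/-- `Θ_{a,b}(μ)`, the image of `μ` under `x ↦ a⁻¹ (x - b)`. -/
def theta (a : Kˣ) (b : B) (μ : FiniteMeasure P) : FiniteMeasure P :=
  μ.map (fun x => a⁻¹ • (-b +ᵥ x))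

/-- The Markov chain with kernel `R` is `(a(n), b(n))`-ergodic with limiting distribution `γ`: for
every initial distribution, `a(n)⁻¹ (W_n - b(n))` converges in distribution to `γ`. -/
def IsErgodic [TopologicalSpace P] [OpensMeasurableSpace P] (R : Kernel P P) [IsMarkovKernel R]
    (a : ℕ → Kˣ) (b : ℕ → B) (γ : ProbabilityMeasure P) : Prop :=
  ∀ μ₀ : ProbabilityMeasure P,
    Tendsto (fun n => theta (a n) (b n) (chainLaw R μ₀ n).toFiniteMeasure) atTop
      (𝓝 γ.toFiniteMeasure)

/-- The distribution of `Γ g(Λ) + f(Λ)`, for independent `Γ ∼ γ` and `Λ ∼ N(0,1)`. -/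
def limitLaw (γ : ProbabilityMeasure P) (f : ℝ → B) (g : ℝ → K) : FiniteMeasure P :=
  ⟨((γ : Measure P).prod (gaussianReal 0 1)).map (fun p => f p.2 +ᵥ g p.2 • p.1), inferInstance⟩

end Normalisation

/-- Convergence in probability of a sequence of random elements of a topological space to a
deterministic limit. -/
def TendstoInProbability {Ω E : Type*} [MeasurableSpace Ω] [TopologicalSpace E] (Pr : Measure Ω)
    (X : ℕ → Ω → E) (l : E) : Prop :=
  ∀ U ∈ 𝓝 l, Tendsto (fun n => Pr {ω | X n ω ∉ U}) atTop (𝓝 0)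

end MVPP

end

/-! The proof is a second-moment argument around a fixed time `j`. Let `m` be the mass of `M₀`. Each
draw adds mass one, so the average of a bounded `h` under the normalised composition at time `n + 1`
has, given the past, a mean equal to the average at time `n` of `(1 - p) h + p R h`, with `p = 1 /
(m + n + 1)`. Iterated backwards from `n` to `j`, this makes the conditional mean the expectation of
`h` along the chain started from `nor (M j)`, run for an independent random number of moves that is
a sum of independent Bernoulli variables (`integral_lazySteps`). Each draw costs at most `C² p²` in
mean square (`lintegral_stepLaw_sq_le`), so all draws after time `j` cost at most `C² / (m + j)`,
uniformly in `n` (`IsMVPP.lintegral_sq_add_le`, `sum_inv_sq_le`).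

There remains the conditional mean for fixed `j`. The number of moves has mean `log n + O(1)` and
looks like `log n + Λ √(log n)` with `Λ` Gaussian (`tendsto_normalizedPoissonBinomial`). At such a
time the chain, normalised at its own time, is close to `Γ ∼ γ`, and `regular` converts this
normalisation into the one at `log n`, which produces `f Λ + g Λ Γ` (`tendsto_integral_chainLaw`).
Independence of `Γ` and `Λ` reflects that of the chain and the number of moves. Ergodicity holds
from every initial law, so the limit forgets the composition at time `j`. Taking `n → ∞` and then `j
→ ∞` yields `L²` convergence for each test function, hence weak convergence in probability. -/

noncomputable section

namespace MVPP

/-! ### Extended continuous mapping for weak convergence -/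

section ContinuousConvergence

/-- The `m`-Lipschitz upper envelope of the functions `G n`, `m ≤ n`. -/
def lipschitzEnvelope {X : Type*} [PseudoMetricSpace X] (G : ℕ → X → ℝ) (m : ℕ) (x : X) : ℝ :=
  ⨆ p : Ici m × X, (G p.1 p.2 - m * dist p.2 x)

variable {X : Type*}

section Envelope

variable [PseudoMetricSpace X] {G : ℕ → X → ℝ} {C : ℝ}

theorem bddAbove_lipschitzEnvelope (hG : ∀ n x, |G n x| ≤ C) (m : ℕ) (x : X) :
    BddAbove (range fun p : Ici m × X => G p.1 p.2 - m * dist p.2 x) := by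
  refine ⟨C, ?_⟩
  rintro _ ⟨p, rfl⟩
  have h1 := (abs_le.1 (hG p.1 p.2)).2
  have h2 : 0 ≤ (m : ℝ) * dist p.2 x := by positivity
  dsimp only
  linarith

theorem le_lipschitzEnvelope (hG : ∀ n x, |G n x| ≤ C) {m n : ℕ} (hmn : m ≤ n) (x : X) :
    G n x ≤ lipschitzEnvelope G m x := by
  have := le_ciSup (bddAbove_lipschitzEnvelope hG m x) (⟨n, hmn⟩, x)
  simpa [lipschitzEnvelope] using this

theorem lipschitzEnvelope_le {m : ℕ} {x : X} {c : ℝ}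
    (h : ∀ n, m ≤ n → ∀ y, G n y - m * dist y x ≤ c) : lipschitzEnvelope G m x ≤ c := by
  have : Nonempty (Ici m × X) := ⟨(⟨m, Set.self_mem_Ici⟩, x)⟩
  exact ciSup_le fun p => h p.1 p.1.2 p.2

theorem abs_lipschitzEnvelope_le (hG : ∀ n x, |G n x| ≤ C) (m : ℕ) (x : X) :
    |lipschitzEnvelope G m x| ≤ C := by
  refine abs_le.2 ⟨(abs_le.1 (hG m x)).1.trans (le_lipschitzEnvelope hG le_rfl x),
    lipschitzEnvelope_le fun n _ y => ?_⟩
  have h1 := (abs_le.1 (hG n y)).2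
  have h2 : 0 ≤ (m : ℝ) * dist y x := by positivity
  linarith

theorem continuous_lipschitzEnvelope (hG : ∀ n x, |G n x| ≤ C) (m : ℕ) :
    Continuous (lipschitzEnvelope G m) := by
  refine (LipschitzWith.of_le_add_mul (m : ℝ≥0) fun x y => lipschitzEnvelope_le
    fun n hn z => ?_).continuous
  have h1 := le_ciSup (bddAbove_lipschitzEnvelope hG m y) (⟨n, hn⟩, z)
  have h2 : (m : ℝ) * dist z y ≤ m * dist z x + m * dist x y := by
    rw [← mul_add]
    exact mul_le_mul_of_nonneg_left (dist_triangle _ _ _) (by positivity)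
  have h3 : G n z - m * dist z y ≤ lipschitzEnvelope G m y := h1
  push_cast
  linarith

/-- In the supremum, points within `r` of `x` contribute values close to `l` by joint convergence,
while farther points pay a penalty of at least `m * r`, which eventually beats the bound `C`. -/
theorem tendsto_lipschitzEnvelope (hG : ∀ n x, |G n x| ≤ C) {x : X} {l : ℝ}
    (h : Tendsto (fun p : ℕ × X => G p.1 p.2) (atTop ×ˢ 𝓝 x) (𝓝 l)) :
    Tendsto (fun m => lipschitzEnvelope G m x) atTop (𝓝 l) := by
  have hlow : Tendsto (fun m => G m x) atTop (𝓝 l) :=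
    h.comp (tendsto_id.prodMk tendsto_const_nhds)
  refine tendsto_order.2 ⟨fun c hc => ?_, fun c hc => ?_⟩
  · filter_upwards [hlow.eventually (lt_mem_nhds hc)] with m hm
    exact hm.trans_le (le_lipschitzEnvelope hG le_rfl x)
  · obtain ⟨c', hlc', hc'⟩ := exists_between hc
    obtain ⟨u, hu, v, hv, huv⟩ := eventually_prod_iff.1 (h.eventually (gt_mem_nhds hlc'))
    obtain ⟨r, hr, hrv⟩ := Metric.eventually_nhds_iff.1 hv
    filter_upwards [eventually_forall_ge_atTop.2 hu,
      (tendsto_natCast_atTop_atTop.atTop_mul_const hr).eventually_ge_atTop (C - c')] with m hm hmr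
    refine (lipschitzEnvelope_le fun n hn y => ?_).trans_lt hc'
    have h2 : 0 ≤ (m : ℝ) * dist y x := by positivity
    rcases lt_or_ge (dist y x) r with hy | hy
    · have := huv (hm n hn) (hrv hy)
      dsimp only at this
      linarith
    · have h1 := (abs_le.1 (hG n y)).2
      have h3 : (m : ℝ) * r ≤ m * dist y x := mul_le_mul_of_nonneg_left hy (by positivity)
      linarith

end Envelope

variable [TopologicalSpace X] [MeasurableSpace X] [OpensMeasurableSpace X]

theorem integrable_of_abs_le {Y : Type*} [MeasurableSpace Y] {μ : Measure Y} [IsFiniteMeasure μ]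
    {h : Y → ℝ} (hm : Measurable h) {C : ℝ} (hC : ∀ x, |h x| ≤ C) : Integrable h μ :=
  Integrable.of_bound hm.aestronglyMeasurable C (ae_of_all _ hC)

/-- The envelope of index `m` is bounded, continuous and above every `G n` with `n ≥ m`, so weak
convergence bounds the limsup of the integrals by its integral under `μ`. Dominated convergence in
`m` then brings this down to the integral of `F`. -/
theorem eventually_integral_lt_of_tendsto_prod [TopologicalSpace.PseudoMetrizableSpace X]
    {μs : ℕ → ProbabilityMeasure X} {μ : ProbabilityMeasure X} (hμ : Tendsto μs atTop (𝓝 μ))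
    {G : ℕ → X → ℝ} {F : X → ℝ} {C : ℝ} (hGm : ∀ n, Measurable (G n)) (hG : ∀ n x, |G n x| ≤ C)
    (hGF : ∀ᵐ x ∂(μ : Measure X),
      Tendsto (fun p : ℕ × X => G p.1 p.2) (atTop ×ˢ 𝓝 x) (𝓝 (F x)))
    {c : ℝ} (hc : ∫ x, F x ∂(μ : Measure X) < c) :
    ∀ᶠ n in atTop, ∫ x, G n x ∂(μs n : Measure X) < c := by
  let := TopologicalSpace.pseudoMetrizableSpacePseudoMetric X
  have hH : Tendsto (fun m => ∫ x, lipschitzEnvelope G m x ∂(μ : Measure X)) atTop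
      (𝓝 (∫ x, F x ∂(μ : Measure X))) := by
    refine tendsto_integral_of_dominated_convergence (fun _ => C)
      (fun m => (continuous_lipschitzEnvelope hG m).measurable.aestronglyMeasurable)
      (integrable_const C) (fun m => ae_of_all _ fun x => abs_lipschitzEnvelope_le hG m x) ?_
    filter_upwards [hGF] with x hx using tendsto_lipschitzEnvelope hG hx
  obtain ⟨m, hm⟩ := (hH.eventually (gt_mem_nhds hc)).exists
  let H : BoundedContinuousFunction X ℝ := BoundedContinuousFunction.ofNormedAddCommGroup
    (lipschitzEnvelope G m) (continuous_lipschitzEnvelope hG m) C (abs_lipschitzEnvelope_le hG m)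
  have hlim := ProbabilityMeasure.tendsto_iff_forall_integral_tendsto.1 hμ H
  filter_upwards [hlim.eventually (gt_mem_nhds hm), eventually_ge_atTop m] with n hn hmn
  refine lt_of_le_of_lt (integral_mono (integrable_of_abs_le (hGm n) (hG n))
    (integrable_of_abs_le (continuous_lipschitzEnvelope hG m).measurable
      (abs_lipschitzEnvelope_le hG m)) fun x => le_lipschitzEnvelope hG hmn x) hn

/-- Extended continuous mapping theorem: integrals of uniformly bounded functions `G n` that
converge continuously to `F` at almost every point, along weakly convergent measures. -/
theorem tendsto_integral_of_tendsto_prod [TopologicalSpace.PseudoMetrizableSpace X]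
    {μs : ℕ → ProbabilityMeasure X} {μ : ProbabilityMeasure X} (hμ : Tendsto μs atTop (𝓝 μ))
    {G : ℕ → X → ℝ} {F : X → ℝ} {C : ℝ} (hGm : ∀ n, Measurable (G n)) (hG : ∀ n x, |G n x| ≤ C)
    (hGF : ∀ᵐ x ∂(μ : Measure X),
      Tendsto (fun p : ℕ × X => G p.1 p.2) (atTop ×ˢ 𝓝 x) (𝓝 (F x))) :
    Tendsto (fun n => ∫ x, G n x ∂(μs n : Measure X)) atTop
      (𝓝 (∫ x, F x ∂(μ : Measure X))) := by
  refine tendsto_order.2 ⟨fun c hc => ?_, fun c hc =>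
    eventually_integral_lt_of_tendsto_prod hμ hGm hG hGF hc⟩
  have := eventually_integral_lt_of_tendsto_prod hμ (G := fun n x => -G n x)
    (F := fun x => -F x) (C := C) (c := -c) (fun n => (hGm n).neg) (by simpa using hG)
    (by filter_upwards [hGF] with x hx using hx.neg) (by rw [integral_neg]; linarith)
  filter_upwards [this] with n hn
  rw [integral_neg] at hn
  linarith

end ContinuousConvergence

/-! ### Normal approximation of sums of independent Bernoulli variables -/

section PoissonBinomial

/-- The law of the sum of `d` independent Bernoulli variables of parameters `p 0, …, p (d - 1)`. -/
def poissonBinomial (p : ℕ → ℝ≥0) : ℕ → Measure ℕ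
  | 0 => Measure.dirac 0
  | d + 1 => (1 - p d) • poissonBinomial p d + p d • (poissonBinomial p d).map Nat.succ

variable {p : ℕ → ℝ≥0}

theorem isProbabilityMeasure_poissonBinomial (hp : ∀ i, p i ≤ 1) (d : ℕ) :
    IsProbabilityMeasure (poissonBinomial p d) := by
  induction d with
  | zero => exact inferInstanceAs (IsProbabilityMeasure (Measure.dirac 0))
  | succ d ih =>
    refine ⟨?_⟩
    have h : (poissonBinomial p d).map Nat.succ univ = 1 := by
      rw [Measure.map_apply measurable_from_top MeasurableSet.univ]
      simp
    rw [poissonBinomial, Measure.add_apply, Measure.smul_apply, Measure.smul_apply, h,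
      measure_univ]
    simp only [ENNReal.smul_def, smul_eq_mul, mul_one]
    rw [← ENNReal.coe_add, tsub_add_cancel_of_le (hp d), ENNReal.coe_one]

theorem integral_poissonBinomial_succ {E : Type*} [NormedAddCommGroup E] [NormedSpace ℝ E]
    (hp : ∀ i, p i ≤ 1) (d : ℕ) {u : ℕ → E} {C : ℝ} (hu : ∀ k, ‖u k‖ ≤ C) :
    ∫ k, u k ∂poissonBinomial p (d + 1) =
      (1 - (p d : ℝ)) • ∫ k, u k ∂poissonBinomial p d +
        (p d : ℝ) • ∫ k, u (k + 1) ∂poissonBinomial p d := by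
  have := isProbabilityMeasure_poissonBinomial hp d
  have hint : ∀ (μ : Measure ℕ) [IsFiniteMeasure μ], Integrable u μ := fun μ _ =>
    Integrable.of_bound (StronglyMeasurable.of_discrete).aestronglyMeasurable C (ae_of_all _ hu)
  rw [poissonBinomial, integral_add_measure (hint _) (hint _), integral_smul_nnreal_measure,
    integral_smul_nnreal_measure, integral_map measurable_from_top.aemeasurable
    (StronglyMeasurable.of_discrete).aestronglyMeasurable]
  simp only [NNReal.smul_def, NNReal.coe_sub (hp d), NNReal.coe_one, Nat.succ_eq_add_one]

theorem integral_poissonBinomial_cexp (hp : ∀ i, p i ≤ 1) (d : ℕ) (s : ℝ) :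
    ∫ k : ℕ, Complex.exp (k * (Complex.I * s)) ∂poissonBinomial p d =
      ∏ i ∈ Finset.range d, (1 + p i * (Complex.exp (Complex.I * s) - 1)) := by
  induction d with
  | zero => simp [poissonBinomial]
  | succ d ih =>
    rw [integral_poissonBinomial_succ hp d (C := 1), Finset.prod_range_succ, ← ih]
    · have : ∀ k : ℕ, Complex.exp (((k + 1 : ℕ) : ℂ) * (Complex.I * s)) =
          Complex.exp (k * (Complex.I * s)) * Complex.exp (Complex.I * s) := fun k => by
        rw [← Complex.exp_add]; push_cast; ring_nf
      simp_rw [this]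
      rw [integral_mul_const]
      simp only [Complex.real_smul]
      push_cast
      ring
    · intro k
      rw [show (k : ℂ) * (Complex.I * s) = ((k * s : ℝ) : ℂ) * Complex.I by push_cast; ring,
        Complex.norm_exp_ofReal_mul_I]

/-- Factors are exchanged one at a time; the others, being in the unit disc, do not amplify the
error. -/
theorem norm_prod_sub_prod_le {ι : Type*} (s : Finset ι) {f g : ι → ℂ} (hf : ∀ i, ‖f i‖ ≤ 1)
    (hg : ∀ i, ‖g i‖ ≤ 1) : ‖∏ i ∈ s, f i - ∏ i ∈ s, g i‖ ≤ ∑ i ∈ s, ‖f i - g i‖ := by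
  classical
  induction s using Finset.induction_on with
  | empty => simp
  | insert a s ha ih =>
    rw [Finset.prod_insert ha, Finset.prod_insert ha, Finset.sum_insert ha]
    have h1 : ‖∏ i ∈ s, f i‖ ≤ 1 := by
      rw [norm_prod]; exact Finset.prod_le_one (fun _ _ => norm_nonneg _) fun i _ => hf i
    calc ‖f a * ∏ i ∈ s, f i - g a * ∏ i ∈ s, g i‖
        = ‖(f a - g a) * ∏ i ∈ s, f i + g a * (∏ i ∈ s, f i - ∏ i ∈ s, g i)‖ := by ring_nf
      _ ≤ ‖f a - g a‖ * ‖∏ i ∈ s, f i‖ + ‖g a‖ * ‖∏ i ∈ s, f i - ∏ i ∈ s, g i‖ := by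
        refine (norm_add_le _ _).trans (by rw [norm_mul, norm_mul])
      _ ≤ ‖f a - g a‖ * 1 + 1 * ‖∏ i ∈ s, f i - ∏ i ∈ s, g i‖ := by
        gcongr; exact hg a
      _ ≤ _ := by linarith

/-- Comparison of the characteristic function of a Poisson-binomial law with that of a Poisson
law. -/
theorem norm_prod_sub_exp_sum_le (hp : ∀ i, p i ≤ 1) (d : ℕ) {s : ℝ} (hs : |s| ≤ 1) :
    ‖∏ i ∈ Finset.range d, (1 + p i * (Complex.exp (Complex.I * s) - 1)) -
      Complex.exp ((∑ i ∈ Finset.range d, (p i : ℝ) : ℝ) * (Complex.exp (Complex.I * s) - 1))‖ ≤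
      s ^ 2 * ∑ i ∈ Finset.range d, (p i : ℝ) ^ 2 := by
  set z := Complex.exp (Complex.I * s) - 1 with hz
  have hzs : ‖z‖ ≤ |s| := Real.norm_exp_I_mul_ofReal_sub_one_le
  have he : ‖Complex.exp (Complex.I * s)‖ = 1 := by
    rw [mul_comm, Complex.norm_exp_ofReal_mul_I]
  have hre : z.re ≤ 0 := by
    have := Complex.re_le_norm (Complex.exp (Complex.I * s))
    rw [hz, Complex.sub_re, Complex.one_re]; linarith
  have h1 : Complex.exp ((∑ i ∈ Finset.range d, (p i : ℝ) : ℝ) * z) =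
      ∏ i ∈ Finset.range d, Complex.exp (p i * z) := by
    rw [← Complex.exp_sum, ← Finset.sum_mul]; push_cast; rfl
  rw [h1, Finset.mul_sum]
  -- The factors lie in the unit disc as a convex combination of `1` and a point of the unit circle,
  -- and as exponentials of numbers with nonpositive real part. Their difference is a second-order
  -- Taylor remainder.
  refine (norm_prod_sub_prod_le _ (fun i => ?_) fun i => ?_).trans
    (Finset.sum_le_sum fun i _ => ?_)
  · have hpi : (p i : ℝ) ≤ 1 := hp i
    calc ‖1 + p i * z‖ = ‖((1 - p i : ℝ) : ℂ) + ((p i : ℝ) : ℂ) * Complex.exp (Complex.I * s)‖ := by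
          rw [hz]; congr 1; push_cast; ring
      _ ≤ ‖((1 - p i : ℝ) : ℂ)‖ + ‖((p i : ℝ) : ℂ) * Complex.exp (Complex.I * s)‖ :=
          norm_add_le _ _
      _ = (1 - p i) + p i * 1 := by
          rw [norm_mul, he, Complex.norm_of_nonneg (by linarith),
            Complex.norm_of_nonneg (p i).coe_nonneg]
      _ ≤ 1 := by linarith
  · rw [Complex.norm_exp]
    refine Real.exp_le_one_iff.2 ?_
    rw [show ((p i : ℝ≥0) : ℂ) = ((p i : ℝ) : ℂ) from rfl, Complex.re_ofReal_mul]
    exact mul_nonpos_of_nonneg_of_nonpos (p i).coe_nonneg hre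
  · have hn : ‖(p i : ℂ) * z‖ ≤ p i * |s| := by
      rw [norm_mul, show ((p i : ℝ≥0) : ℂ) = ((p i : ℝ) : ℂ) from rfl,
        Complex.norm_of_nonneg (p i).coe_nonneg]
      gcongr
    have hn1 : ‖(p i : ℂ) * z‖ ≤ 1 :=
      hn.trans (mul_le_one₀ (hp i) (abs_nonneg _) hs)
    calc ‖1 + p i * z - Complex.exp (p i * z)‖ = ‖Complex.exp (p i * z) - 1 - p i * z‖ := by
          rw [← norm_neg]; congr 1; ring
      _ ≤ ‖(p i : ℂ) * z‖ ^ 2 := Complex.norm_exp_sub_one_sub_id_le hn1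
      _ ≤ (p i * |s|) ^ 2 := by gcongr
      _ = s ^ 2 * (p i : ℝ) ^ 2 := by rw [mul_pow, sq_abs]; ring

theorem charFun_map_poissonBinomial (hp : ∀ i, p i ≤ 1) (d : ℕ) (c σ t : ℝ) :
    charFun ((poissonBinomial p d).map fun k : ℕ => ((k : ℝ) - c) / σ) t =
      Complex.exp (-(Complex.I * (t / σ : ℝ) * c)) *
        ∏ i ∈ Finset.range d, (1 + p i * (Complex.exp (Complex.I * (t / σ : ℝ)) - 1)) := by
  rw [charFun_apply_real, integral_map measurable_from_top.aemeasurable (by fun_prop),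
    ← integral_poissonBinomial_cexp hp, ← integral_const_mul]
  congr 1 with k
  rw [← Complex.exp_add]
  congr 1
  push_cast
  ring

/-- With `s = t / √L` and `z = exp (i s) - 1`, Poisson comparison costs at most `s² D → 0`. The
centred Poisson exponent is `(σ - L) z + L (z - i s)`: the first term vanishes because `σ - L` is
bounded, and the second tends to `-t² / 2`. -/
theorem tendsto_charFun_poissonBinomial (hp : ∀ i, p i ≤ 1) {D : ℝ}
    (hD : ∀ d, ∑ i ∈ Finset.range d, (p i : ℝ) ^ 2 ≤ D) {d : ℕ → ℕ} {L : ℕ → ℝ}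
    (hL : Tendsto L atTop atTop) {C : ℝ}
    (hC : ∀ᶠ n in atTop, |∑ i ∈ Finset.range (d n), (p i : ℝ) - L n| ≤ C) (t : ℝ) :
    Tendsto (fun n => charFun ((poissonBinomial p (d n)).map
      fun k : ℕ => ((k : ℝ) - L n) / √(L n)) t) atTop (𝓝 (charFun (gaussianReal 0 1) t)) := by
  have hs : Tendsto (fun n => t / √(L n)) atTop (𝓝 0) :=
    tendsto_const_nhds.div_atTop (Real.tendsto_sqrt_atTop.comp hL)
  set s : ℕ → ℝ := fun n => t / √(L n) with hs_def
  set σ : ℕ → ℝ := fun n => ∑ i ∈ Finset.range (d n), (p i : ℝ) with hσ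
  let z : ℕ → ℂ := fun n => Complex.exp (Complex.I * s n) - 1
  have hz : Tendsto z atTop (𝓝 0) := by
    have : Continuous fun x : ℝ => Complex.exp (Complex.I * x) - 1 := by fun_prop
    have h0 := (this.tendsto 0).comp hs
    simp only [Complex.ofReal_zero, mul_zero, Complex.exp_zero, sub_self] at h0
    exact h0
  have hs1 : ∀ᶠ n in atTop, |s n| ≤ 1 := by
    have h0 := hs.abs
    rw [abs_zero] at h0
    exact h0.eventually (ge_mem_nhds one_pos)
  have hquad : Tendsto (fun n => (L n : ℂ) * (z n - Complex.I * s n)) atTop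
      (𝓝 (-(t : ℂ) ^ 2 / 2)) := by
    have hdiff : Tendsto (fun n => (L n : ℂ) * (z n - Complex.I * s n) - -(t : ℂ) ^ 2 / 2) atTop
        (𝓝 0) := by
      have hb : Tendsto (fun n => t ^ 2 * |s n|) atTop (𝓝 0) := by
        simpa using hs.abs.const_mul (t ^ 2)
      refine squeeze_zero_norm' ?_ hb
      filter_upwards [hL.eventually_gt_atTop 0, hs1] with n hLn hsn
      have hsq : (L n : ℂ) * (s n : ℂ) ^ 2 = (t : ℂ) ^ 2 := by
        norm_cast
        rw [hs_def]
        simp only [div_pow, Real.sq_sqrt hLn.le]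
        field_simp
      have hsq' : L n * s n ^ 2 = t ^ 2 := by exact_mod_cast hsq
      have hx : ‖Complex.I * (s n : ℂ)‖ = |s n| := by simp
      have key := Complex.exp_bound (x := Complex.I * (s n : ℂ)) (by rw [hx]; exact hsn)
        (n := 3) (by norm_num)
      rw [hx] at key
      have e1 : ∑ m ∈ Finset.range 3, (Complex.I * (s n : ℂ)) ^ m / (m.factorial : ℂ) =
          1 + Complex.I * s n - (s n : ℂ) ^ 2 / 2 := by
        simp [Finset.sum_range_succ, mul_pow]
        ring
      rw [e1] at key
      calc ‖(L n : ℂ) * (z n - Complex.I * s n) - -(t : ℂ) ^ 2 / 2‖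
          = ‖(L n : ℂ) * (Complex.exp (Complex.I * s n) -
              (1 + Complex.I * s n - (s n : ℂ) ^ 2 / 2))‖ := by
            rw [← hsq]; simp only [z]; congr 1; ring
        _ ≤ L n * (|s n| ^ 3 * 1) := by
            rw [norm_mul, Complex.norm_of_nonneg hLn.le]
            gcongr
            refine key.trans ?_
            gcongr
            norm_num [Nat.factorial]
        _ = t ^ 2 * |s n| := by rw [← hsq', ← sq_abs (s n)]; ring
    have h0 := hdiff.add_const (-(t : ℂ) ^ 2 / 2)
    simp only [sub_add_cancel, zero_add] at h0
    exact h0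
  have hlin : Tendsto (fun n => ((σ n - L n : ℝ) : ℂ) * z n) atTop (𝓝 0) := by
    refine squeeze_zero_norm' (a := fun n => C * ‖z n‖) ?_ (by simpa using hz.norm.const_mul C)
    filter_upwards [hC] with n hn
    rw [norm_mul, Complex.norm_real]
    gcongr
    exact hn
  have hexp : Tendsto (fun n => Complex.exp (-(Complex.I * s n * L n)) *
      Complex.exp ((σ n : ℝ) * z n)) atTop (𝓝 (Complex.exp (-(t : ℂ) ^ 2 / 2))) := by
    have := (Complex.continuous_exp.tendsto _).comp (hlin.add hquad)
    rw [zero_add] at this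
    refine this.congr fun n => ?_
    simp only [Function.comp]
    rw [← Complex.exp_add]
    congr 1
    push_cast
    ring
  have herr : Tendsto (fun n => Complex.exp (-(Complex.I * s n * L n)) *
      (∏ i ∈ Finset.range (d n), (1 + p i * z n) - Complex.exp ((σ n : ℝ) * z n))) atTop
      (𝓝 0) := by
    have hb : Tendsto (fun n => s n ^ 2 * D) atTop (𝓝 0) := by
      simpa using (hs.pow 2).mul_const D
    refine squeeze_zero_norm' ?_ hb
    filter_upwards [hs1]
      with n hsn
    rw [norm_mul, show -(Complex.I * s n * L n) = ((-(s n * L n) : ℝ) : ℂ) * Complex.I by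
      push_cast; ring, Complex.norm_exp_ofReal_mul_I, one_mul]
    exact (norm_prod_sub_exp_sum_le hp (d n) hsn).trans
      (mul_le_mul_of_nonneg_left (hD _) (sq_nonneg _))
  have hlim : charFun (gaussianReal 0 1) t = Complex.exp (-(t : ℂ) ^ 2 / 2) + 0 := by
    rw [charFun_gaussianReal]; simp [neg_div]
  rw [hlim]
  refine (hexp.add herr).congr fun n => ?_
  rw [charFun_map_poissonBinomial hp]
  simp only [z, s]
  ring

/-- The law of the normalised sum of independent Bernoulli variables. -/
def normalizedPoissonBinomial (hp : ∀ i, p i ≤ 1) (d : ℕ) (c : ℝ) : ProbabilityMeasure ℝ :=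
  ⟨(poissonBinomial p d).map fun k : ℕ => ((k : ℝ) - c) / √c,
    have := isProbabilityMeasure_poissonBinomial hp d
    Measure.isProbabilityMeasure_map measurable_from_top.aemeasurable⟩

theorem tendsto_normalizedPoissonBinomial (hp : ∀ i, p i ≤ 1) {D : ℝ}
    (hD : ∀ d, ∑ i ∈ Finset.range d, (p i : ℝ) ^ 2 ≤ D) {d : ℕ → ℕ} {L : ℕ → ℝ}
    (hL : Tendsto L atTop atTop) {C : ℝ}
    (hC : ∀ᶠ n in atTop, |∑ i ∈ Finset.range (d n), (p i : ℝ) - L n| ≤ C) :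
    Tendsto (fun n => normalizedPoissonBinomial hp (d n) (L n)) atTop
      (𝓝 ⟨gaussianReal 0 1, inferInstance⟩) :=
  ProbabilityMeasure.tendsto_of_tendsto_charFun fun t =>
    tendsto_charFun_poissonBinomial hp hD hL hC t

/-- Telescoping of `1 / (x + 1)² ≤ 1 / x - 1 / (x + 1)`. It controls both the Poisson comparison
error and the fluctuations of the urn; for the latter it matters that `m⁻¹ → 0` as `m → ∞`. -/
theorem sum_inv_sq_le {m : ℝ} (hm : 0 < m) (d : ℕ) :
    ∑ i ∈ Finset.range d, ((m + i + 1)⁻¹) ^ 2 ≤ m⁻¹ - (m + d)⁻¹ := by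
  induction d with
  | zero => simp
  | succ d ih =>
    rw [Finset.sum_range_succ]
    have hx : 0 < m + d := by positivity
    have : ((m + d + 1)⁻¹) ^ 2 ≤ (m + d)⁻¹ - (m + (d + 1 : ℕ))⁻¹ := by
      push_cast
      rw [← add_assoc, inv_sub_inv hx.ne' (by positivity), inv_pow, ← one_div,
        div_le_div_iff₀ (by positivity) (by positivity)]
      nlinarith
    linarith

theorem sum_inv_le_log {m : ℝ} (hm : 0 < m) (d : ℕ) :
    ∑ i ∈ Finset.range d, (m + i + 1)⁻¹ ≤ Real.log (m + d) - Real.log m := by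
  induction d with
  | zero => simp
  | succ d ih =>
    rw [Finset.sum_range_succ]
    have hx : 0 < m + d := by positivity
    have h := Real.one_sub_inv_le_log_of_pos (x := (m + d + 1) / (m + d)) (by positivity)
    rw [Real.log_div (by positivity) (by positivity), inv_div] at h
    have : 1 - (m + d) / (m + d + 1) = (m + d + 1)⁻¹ := by field_simp; ring
    push_cast
    rw [← add_assoc]
    linarith

theorem log_le_sum_inv {m : ℝ} (hm : 0 < m) (d : ℕ) :
    Real.log (m + d + 1) - Real.log (m + 1) ≤ ∑ i ∈ Finset.range d, (m + i + 1)⁻¹ := by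
  induction d with
  | zero => simp
  | succ d ih =>
    rw [Finset.sum_range_succ]
    have hx : 0 < m + d := by positivity
    have h := Real.log_le_sub_one_of_pos (x := (m + d + 1 + 1) / (m + d + 1)) (by positivity)
    rw [Real.log_div (by positivity) (by positivity)] at h
    have : (m + d + 1 + 1) / (m + d + 1) - 1 = (m + d + 1)⁻¹ := by field_simp; ring
    push_cast
    rw [← add_assoc]
    linarith

/-- The mean number of moves between times `j` and `n` is `log n` up to an error independent of `n`,
negligible against `√(log n)`. -/
theorem abs_sum_inv_sub_log_le {m : ℝ} (hm : 0 < m) (j : ℕ) {n : ℕ} (hn : 1 ≤ n) :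
    |∑ i ∈ Finset.range (n - j), (m + i + 1)⁻¹ - Real.log n| ≤
      Real.log (m + 1) + Real.log (j + 1) + |Real.log m| := by
  have hn' : (1 : ℝ) ≤ n := by exact_mod_cast hn
  have hj : 0 ≤ Real.log ((j : ℝ) + 1) := Real.log_nonneg (by linarith [j.cast_nonneg (α := ℝ)])
  have hm1 : 0 ≤ Real.log (m + 1) := Real.log_nonneg (by linarith)
  have h1 := sum_inv_le_log hm (n - j)
  have h2 := log_le_sum_inv hm (n - j)
  have h3 : ((n - j : ℕ) : ℝ) ≤ n := by exact_mod_cast Nat.sub_le n j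
  have h4 : (n : ℝ) ≤ (n - j : ℕ) + j := by exact_mod_cast (by omega : n ≤ n - j + j)
  have h0 : (0 : ℝ) ≤ (n - j : ℕ) := Nat.cast_nonneg _
  have h5 : Real.log (m + (n - j : ℕ)) ≤ Real.log (m + 1) + Real.log n := by
    rw [← Real.log_mul (by positivity) (by positivity)]
    exact Real.log_le_log (by positivity) (by nlinarith)
  have h6 : Real.log n ≤ Real.log (m + (n - j : ℕ) + 1) + Real.log (j + 1) := by
    rw [← Real.log_mul (by positivity) (by positivity)]
    exact Real.log_le_log (by positivity) (by nlinarith [j.cast_nonneg (α := ℝ)])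
  have h7 := neg_abs_le (Real.log m)
  have h8 := abs_nonneg (Real.log m)
  rw [abs_le]
  constructor <;> linarith

end PoissonBinomial

/-! ### The chain at a random time around `log n` -/

section MeanConvergence

/-- Convergence along all perturbations of order `o(√t)` is joint convergence in `(t, y)`. -/
theorem tendsto_prod_of_forall_isLittleO {Z : Type*} [TopologicalSpace Z] {r : ℝ → ℝ → Z} {x : ℝ}
    {z : Z} (h : ∀ ε : ℝ → ℝ, ε =o[atTop] (fun t : ℝ => √t) →
      Tendsto (fun t => r t (t + x * √t + ε t)) atTop (𝓝 z)) :
    Tendsto (fun q : ℝ × ℝ => r q.1 (q.1 + q.2 * √q.1)) (atTop ×ˢ 𝓝 x) (𝓝 z) := by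
  refine tendsto_of_seq_tendsto fun u hu => tendsto_of_subseq_tendsto fun ns hns => ?_
  have hv := hu.comp hns
  have hv1 : Tendsto (fun k => (u (ns k)).1) atTop atTop := tendsto_fst.comp hv
  have hv2 : Tendsto (fun k => (u (ns k)).2) atTop (𝓝 x) := tendsto_snd.comp hv
  -- Along a subsequence with strictly increasing times, the second coordinates minus `x` are the
  -- values of a function `η` of time, set to zero elsewhere; then `ε t = η t * √t` is an admissible
  -- perturbation.
  obtain ⟨φ, hφ, hmono⟩ := strictMono_subseq_of_tendsto_atTop hv1
  refine ⟨φ, ?_⟩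
  set T : ℕ → ℝ := (fun k => (u (ns k)).1) ∘ φ with hT
  let η : ℝ → ℝ := Function.extend T (fun k => (u (ns (φ k))).2 - x) 0
  have hη : Tendsto η atTop (𝓝 0) := by
    rw [Metric.tendsto_atTop]
    intro c hc
    obtain ⟨N, hN⟩ := Metric.tendsto_atTop.1 (hv2.comp hφ.tendsto_atTop) c hc
    refine ⟨T N, fun t ht => ?_⟩
    by_cases hex : ∃ k, T k = t
    · obtain ⟨k, rfl⟩ := hex
      simp only [η, hmono.injective.extend_apply]
      have := hN k (hmono.le_iff_le.1 ht)
      simpa [Real.dist_eq] using this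
    · simp only [η, Function.extend_apply' _ _ _ hex, Pi.zero_apply, dist_self, hc]
  have hε : (fun t => η t * √t) =o[atTop] (fun t : ℝ => √t) := by
    have := ((Asymptotics.isLittleO_one_iff ℝ).2 hη).mul_isBigO
      (Asymptotics.isBigO_refl (fun t : ℝ => √t) atTop)
    simpa using this
  refine ((h _ hε).comp (hv1.comp hφ.tendsto_atTop)).congr fun k => ?_
  have hk : η (u (ns (φ k))).1 = (u (ns (φ k))).2 - x := hmono.injective.extend_apply _ _ k
  simp only [Function.comp, hk]
  congr 1
  ring

theorem tendsto_floor_add_mul_sqrt (x : ℝ) :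
    Tendsto (fun q : ℝ × ℝ => ⌊q.1 + q.2 * √q.1⌋₊) (atTop ×ˢ 𝓝 x) atTop := by
  refine tendsto_nat_floor_atTop.comp ?_
  have h1 : Tendsto (fun q : ℝ × ℝ => √q.1) (atTop ×ˢ 𝓝 x) atTop :=
    Real.tendsto_sqrt_atTop.comp tendsto_fst
  refine (h1.atTop_mul_atTop₀ (h1.atTop_add (tendsto_snd (f := atTop) (g := 𝓝 x)))).congr' ?_
  filter_upwards [tendsto_fst.eventually (eventually_ge_atTop (0 : ℝ))] with q hq
  rw [mul_add, Real.mul_self_sqrt hq]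
  ring

/-- An integer `k` is recovered exactly from `y = (k - L) / √L` as `⌊L + y √L⌋₊`, so this is an
integral against the normalised law. Exceptional points are Lebesgue-null, hence Gaussian-null. -/
theorem tendsto_integral_poissonBinomial {p : ℕ → ℝ≥0} (hp : ∀ i, p i ≤ 1) {D : ℝ}
    (hD : ∀ d, ∑ i ∈ Finset.range d, (p i : ℝ) ^ 2 ≤ D) {d : ℕ → ℕ} {L : ℕ → ℝ}
    (hL : Tendsto L atTop atTop) {C : ℝ}
    (hC : ∀ᶠ n in atTop, |∑ i ∈ Finset.range (d n), (p i : ℝ) - L n| ≤ C)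
    {v : ℕ → ℕ → ℝ} {C' : ℝ} (hv : ∀ n k, |v n k| ≤ C') {F : ℝ → ℝ}
    (hF : ∀ᵐ x : ℝ, Tendsto (fun q : ℕ × ℝ => v q.1 ⌊L q.1 + q.2 * √(L q.1)⌋₊)
      (atTop ×ˢ 𝓝 x) (𝓝 (F x))) :
    Tendsto (fun n => ∫ k, v n k ∂poissonBinomial p (d n)) atTop
      (𝓝 (∫ x, F x ∂gaussianReal 0 1)) := by
  have hm : ∀ n, Measurable fun y : ℝ => v n ⌊L n + y * √(L n)⌋₊ := fun n =>
    (measurable_from_top (f := v n)).comp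
      (Nat.measurable_floor.comp ((measurable_id.mul_const _).const_add _))
  have key := tendsto_integral_of_tendsto_prod
    (tendsto_normalizedPoissonBinomial hp hD hL hC) hm (fun n y => hv n _)
    ((gaussianReal_absolutelyContinuous 0 one_ne_zero).ae_le hF)
  refine key.congr' ?_
  filter_upwards [hL.eventually_gt_atTop 0] with n hn
  refine (integral_map measurable_from_top.aemeasurable
    (hm n).aestronglyMeasurable).trans (integral_congr_ae (ae_of_all _ fun k => ?_))
  have : L n + ((k : ℝ) - L n) / √(L n) * √(L n) = k := by
    rw [div_mul_cancel₀ _ (Real.sqrt_pos.2 hn).ne']; ring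
  simp only [this, Nat.floor_natCast]

theorem continuous_normalization {P B K : Type*} [TopologicalSpace P] [AddCommGroup B]
    [TopologicalSpace B] [AddAction B P] [ContinuousVAdd B P] [CommMonoid K] [TopologicalSpace K]
    [MulAction K P] [ContinuousSMul K P] (a : Kˣ) (b : B) :
    Continuous fun x : P => a⁻¹ • (-b +ᵥ x) := by
  simp_rw [Units.smul_def]
  fun_prop

theorem change_normalization {P B K : Type*} [AddCommGroup B] [AddAction B P] [CommMonoid K]
    [MulAction K P] [DistribMulAction K B]
    (smul_vadd : ∀ (k : K) (c : B) (x : P), k • (c +ᵥ x) = (k • c) +ᵥ (k • x))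
    (a a' : Kˣ) (b b' : B) (w : P) :
    (a⁻¹ • (b' - b)) +ᵥ ((a' / a : Kˣ) : K) • (a'⁻¹ • (-b' +ᵥ w)) = a⁻¹ • (-b +ᵥ w) := by
  have h : ∀ (k : Kˣ) (c : B) (x : P), k • (c +ᵥ x) = (k • c) +ᵥ (k • x) :=
    fun k c x => smul_vadd k c x
  rw [← Units.smul_def, ← mul_smul, show a' / a * a'⁻¹ = a⁻¹ by
    rw [div_eq_mul_inv, mul_right_comm, mul_inv_cancel, one_mul], h, h, vadd_vadd, ← smul_add]
  congr 2
  abel_nf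

variable {P : Type*} [TopologicalSpace P] [PolishSpace P] [MeasurableSpace P] [BorelSpace P]
  {B : Type*} [AddCommGroup B] [TopologicalSpace B] [AddAction B P] [ContinuousVAdd B P]
  {K : Type*} [CommMonoid K] [TopologicalSpace K] [MulAction K P] [ContinuousSMul K P]

/-- By ergodicity, the chain at time `N = ⌊t + y √t⌋₊`, normalised at `N`, tends to `γ`. Passing to
the normalisation at `t` applies an affine map (`change_normalization`) whose coefficients tend to
`c` and `k`, so the extended continuous mapping theorem applies. -/
theorem tendsto_integral_chainLaw [DistribMulAction K B]
    (smul_vadd : ∀ (k : K) (c : B) (x : P), k • (c +ᵥ x) = (k • c) +ᵥ (k • x))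
    {R : Kernel P P} [IsMarkovKernel R] {a : ℝ → Kˣ} {b : ℝ → B} {γ : ProbabilityMeasure P}
    (ergodic : IsErgodic R (fun n : ℕ => a n) (fun n : ℕ => b n) γ)
    {x : ℝ} {c : B} {k : K}
    (regular : ∀ ε : ℝ → ℝ, ε =o[atTop] (fun t : ℝ => √t) →
      Tendsto (fun t : ℝ => (a t)⁻¹ • (b (⌊t + x * √t + ε t⌋₊ : ℕ) - b t)) atTop (𝓝 c) ∧
      Tendsto (fun t : ℝ => ((a (⌊t + x * √t + ε t⌋₊ : ℕ) / a t : Kˣ) : K)) atTop (𝓝 k))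
    (μ₀ : ProbabilityMeasure P) (φ : BoundedContinuousFunction P ℝ) :
    Tendsto (fun q : ℝ × ℝ => ∫ w, φ ((a q.1)⁻¹ • (-(b q.1) +ᵥ w))
        ∂(chainLaw R μ₀ ⌊q.1 + q.2 * √q.1⌋₊ : Measure P)) (atTop ×ˢ 𝓝 x)
      (𝓝 (∫ w, φ (c +ᵥ k • w) ∂(γ : Measure P))) := by
  have hshift := tendsto_prod_of_forall_isLittleO
    (r := fun t s => (a t)⁻¹ • (b (⌊s⌋₊ : ℕ) - b t)) fun ε hε => (regular ε hε).1
  have hscale := tendsto_prod_of_forall_isLittleO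
    (r := fun t s => ((a (⌊s⌋₊ : ℕ) / a t : Kˣ) : K)) fun ε hε => (regular ε hε).2
  refine tendsto_of_seq_tendsto fun u hu => ?_
  have hN := (tendsto_floor_add_mul_sqrt x).comp hu
  replace hshift := hshift.comp hu
  replace hscale := hscale.comp hu
  set N : ℕ → ℕ := fun j => ⌊(u j).1 + (u j).2 * √(u j).1⌋₊
  have hm : ∀ n : ℕ, Measurable fun w : P => (a n)⁻¹ • (-(b n) +ᵥ w) := fun n =>
    (continuous_normalization _ _).measurable
  let X : ℕ → ProbabilityMeasure P := fun n => (chainLaw R μ₀ n).map (hm n).aemeasurable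
  have hX : Tendsto X atTop (𝓝 γ) :=
    (ProbabilityMeasure.tendsto_nhds_iff_toFiniteMeasure_tendsto_nhds _).2 (ergodic μ₀)
  have hcont : ∀ j, Continuous fun y : P => φ (((a (u j).1)⁻¹ • (b (N j) - b (u j).1)) +ᵥ
      ((a (N j) / a (u j).1 : Kˣ) : K) • y) := fun j => by fun_prop
  have key := tendsto_integral_of_tendsto_prod (hX.comp hN)
    (G := fun j y => φ (((a (u j).1)⁻¹ • (b (N j) - b (u j).1)) +ᵥ
      ((a (N j) / a (u j).1 : Kˣ) : K) • y)) (F := fun y => φ (c +ᵥ k • y)) (C := ‖φ‖)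
    (fun j => (hcont j).measurable) (fun j y => φ.norm_coe_le_norm _) (ae_of_all _ fun y => by
      refine (φ.continuous.tendsto _).comp ?_
      exact (hshift.comp tendsto_fst).vadd ((hscale.comp tendsto_fst).smul tendsto_snd))
  refine key.congr fun j => ?_
  have : ((X ∘ fun j => N j) j : Measure P) =
      (chainLaw R μ₀ (N j) : Measure P).map fun w => (a (N j))⁻¹ • (-(b (N j)) +ᵥ w) := rfl
  refine (congrArg (fun μ : Measure P => ∫ y, φ (((a (u j).1)⁻¹ • (b (N j) - b (u j).1)) +ᵥ
      ((a (N j) / a (u j).1 : Kˣ) : K) • y) ∂μ) this).trans ?_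
  rw [integral_map (hm _).aemeasurable (hcont j).measurable.aestronglyMeasurable]
  simp_rw [change_normalization smul_vadd]
  rfl

variable [MeasurableSpace B] [BorelSpace B] [MeasurableSpace K] [BorelSpace K]

theorem integral_limitLaw {γ : ProbabilityMeasure P} {f : ℝ → B} {g : ℝ → K} (hf : Measurable f)
    (hg : Measurable g) (φ : BoundedContinuousFunction P ℝ) :
    ∫ w, φ w ∂(limitLaw γ f g : Measure P) =
      ∫ x, ∫ w, φ (f x +ᵥ g x • w) ∂(γ : Measure P) ∂(gaussianReal 0 1) := by
  have hm : Measurable fun p : P × ℝ => f p.2 +ᵥ g p.2 • p.1 := by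
    have h1 : Measurable fun q : K × P => q.1 • q.2 := continuous_smul.measurable
    have h2 : Measurable fun q : B × P => q.1 +ᵥ q.2 := continuous_vadd.measurable
    exact h2.comp ((hf.comp measurable_snd).prodMk
      (h1.comp ((hg.comp measurable_snd).prodMk measurable_fst)))
  change ∫ w, φ w ∂(((γ : Measure P).prod (gaussianReal 0 1)).map
    (fun p => f p.2 +ᵥ g p.2 • p.1)) = _
  rw [integral_map hm.aemeasurable φ.continuous.measurable.aestronglyMeasurable,
    integral_prod_symm (fun p : P × ℝ => φ (f p.2 +ᵥ g p.2 • p.1))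
      (integrable_of_abs_le (φ.continuous.measurable.comp hm) fun p => φ.norm_coe_le_norm _)]

theorem tendsto_integral_poissonBinomial_chainLaw [DistribMulAction K B]
    (smul_vadd : ∀ (k : K) (c : B) (x : P), k • (c +ᵥ x) = (k • c) +ᵥ (k • x))
    {R : Kernel P P} [IsMarkovKernel R] {a : ℝ → Kˣ} {b : ℝ → B} {γ : ProbabilityMeasure P}
    (ergodic : IsErgodic R (fun n : ℕ => a n) (fun n : ℕ => b n) γ)
    {f : ℝ → B} {g : ℝ → K} (hf : Measurable f) (hg : Measurable g)
    (regular : ∀ᵐ x : ℝ, ∀ ε : ℝ → ℝ, ε =o[atTop] (fun t : ℝ => √t) →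
      Tendsto (fun t : ℝ => (a t)⁻¹ • (b (⌊t + x * √t + ε t⌋₊ : ℕ) - b t)) atTop (𝓝 (f x)) ∧
      Tendsto (fun t : ℝ => ((a (⌊t + x * √t + ε t⌋₊ : ℕ) / a t : Kˣ) : K)) atTop (𝓝 (g x)))
    (μ₀ : ProbabilityMeasure P) (φ : BoundedContinuousFunction P ℝ)
    {p : ℕ → ℝ≥0} (hp : ∀ i, p i ≤ 1) {D : ℝ}
    (hD : ∀ d, ∑ i ∈ Finset.range d, (p i : ℝ) ^ 2 ≤ D) {d : ℕ → ℕ} {C : ℝ}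
    (hC : ∀ᶠ n : ℕ in atTop, |∑ i ∈ Finset.range (d n), (p i : ℝ) - Real.log n| ≤ C) :
    Tendsto (fun n : ℕ => ∫ k, (∫ w, φ ((a (Real.log n))⁻¹ • (-(b (Real.log n)) +ᵥ w))
        ∂(chainLaw R μ₀ k : Measure P)) ∂poissonBinomial p (d n)) atTop
      (𝓝 (∫ w, φ w ∂(limitLaw γ f g : Measure P))) := by
  have hL : Tendsto (fun n : ℕ => Real.log n) atTop atTop :=
    Real.tendsto_log_atTop.comp tendsto_natCast_atTop_atTop
  rw [integral_limitLaw hf hg]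
  refine tendsto_integral_poissonBinomial hp hD hL hC (C' := ‖φ‖)
    (v := fun n k => ∫ w, φ ((a (Real.log n))⁻¹ • (-(b (Real.log n)) +ᵥ w))
      ∂(chainLaw R μ₀ k : Measure P)) (F := fun x => ∫ w, φ (f x +ᵥ g x • w) ∂(γ : Measure P))
    (fun n k => ?_) ?_
  · have := norm_integral_le_of_norm_le_const (μ := (chainLaw R μ₀ k : Measure P))
      (ae_of_all _ fun w => φ.norm_coe_le_norm ((a (Real.log n))⁻¹ • (-(b (Real.log n)) +ᵥ w)))
    simpa using this
  · filter_upwards [regular] with x hx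
    have hq : Tendsto (fun q : ℕ × ℝ => (Real.log q.1, q.2)) (atTop ×ˢ 𝓝 x) (atTop ×ˢ 𝓝 x) :=
      (hL.comp tendsto_fst).prodMk tendsto_snd
    have h := (tendsto_integral_chainLaw smul_vadd ergodic hx μ₀ φ).comp hq
    simpa only [Function.comp_def] using h

end MeanConvergence

/-! ### Lazy steps as a chain run for a random number of moves -/

section Averaging

variable {P : Type*} [MeasurableSpace P]

/-- One lazy step of the chain with kernel `R`, which moves with probability `p`, acting on
functions. -/
def lazyStep (R : Kernel P P) (p : ℝ≥0) (h : P → ℝ) : P → ℝ :=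
  fun x => (1 - p) * h x + p * ∫ y, h y ∂(R x)

/-- The action on functions of `d` lazy steps, with successive moving probabilities `p i`. -/
def lazySteps (R : Kernel P P) (p : ℕ → ℝ≥0) : ℕ → (P → ℝ) → P → ℝ
  | 0, h => h
  | d + 1, h => lazySteps R p d (lazyStep R (p d) h)

variable {R : Kernel P P} [IsMarkovKernel R] {h : P → ℝ} {C : ℝ}

theorem measurable_integral_kernel {α : Type*} [MeasurableSpace α] (κ : Kernel α P)
    (hm : Measurable h) : Measurable fun x => ∫ y, h y ∂κ x :=
  (hm.stronglyMeasurable.integral_kernel (κ := κ)).measurable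

theorem integral_comp_measure (hm : Measurable h) (hC : ∀ x, |h x| ≤ C) {μ : Measure P}
    [IsProbabilityMeasure μ] : ∫ x, h x ∂(R ∘ₘ μ) = ∫ x, ∫ y, h y ∂(R x) ∂μ := by
  have := Kernel.integral_comp (κ := Kernel.const Unit μ) (η := R) (a := ())
    (integrable_of_abs_le hm hC)
  rwa [← Measure.comp_eq_comp_const_apply, Kernel.const_apply] at this

theorem abs_integral_le_of_abs_le {μ : Measure P} [IsProbabilityMeasure μ]
    (hC : ∀ x, |h x| ≤ C) : |∫ y, h y ∂μ| ≤ C := by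
  have h1 : ∀ x, ‖h x‖ ≤ C := hC
  simpa using norm_integral_le_of_norm_le_const (μ := μ) (ae_of_all _ h1)

omit [IsMarkovKernel R] in
theorem measurable_lazyStep (hm : Measurable h) (p : ℝ≥0) : Measurable (lazyStep R p h) :=
  (hm.const_mul _).add ((measurable_integral_kernel R hm).const_mul _)

theorem abs_lazyStep_le (hC : ∀ x, |h x| ≤ C) {p : ℝ≥0} (hp : p ≤ 1) (x : P) :
    |lazyStep R p h x| ≤ C := by
  have hp' : (p : ℝ) ≤ 1 := hp
  have h0 : 0 ≤ 1 - (p : ℝ) := by linarith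
  calc |lazyStep R p h x| ≤ |(1 - (p : ℝ)) * h x| + |p * ∫ y, h y ∂(R x)| := abs_add_le _ _
    _ = (1 - p) * |h x| + p * |∫ y, h y ∂(R x)| := by
      rw [abs_mul, abs_mul, abs_of_nonneg h0, abs_of_nonneg p.coe_nonneg]
    _ ≤ (1 - p) * C + p * C :=
      add_le_add (mul_le_mul_of_nonneg_left (hC x) h0)
        (mul_le_mul_of_nonneg_left (abs_integral_le_of_abs_le hC) p.coe_nonneg)
    _ = C := by ring

omit [IsMarkovKernel R] in
theorem measurable_lazySteps (p : ℕ → ℝ≥0) (d : ℕ) {h : P → ℝ} (hm : Measurable h) :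
    Measurable (lazySteps R p d h) := by
  induction d generalizing h with
  | zero => exact hm
  | succ d ih => exact ih (measurable_lazyStep hm _)

theorem abs_lazySteps_le {p : ℕ → ℝ≥0} (hp : ∀ i, p i ≤ 1) (d : ℕ) {h : P → ℝ}
    (hC : ∀ x, |h x| ≤ C) (x : P) : |lazySteps R p d h x| ≤ C := by
  induction d generalizing h with
  | zero => exact hC x
  | succ d ih => exact ih (abs_lazyStep_le hC (hp d))

theorem integral_lazyStep {μ : Measure P} [IsProbabilityMeasure μ] (hm : Measurable h)
    (hC : ∀ x, |h x| ≤ C) (p : ℝ≥0) :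
    ∫ x, lazyStep R p h x ∂μ = (1 - p) * ∫ x, h x ∂μ + p * ∫ x, ∫ y, h y ∂(R x) ∂μ := by
  unfold lazyStep
  rw [integral_add ((integrable_of_abs_le hm hC).const_mul _)
    ((integrable_of_abs_le (measurable_integral_kernel R hm)
      fun x => abs_integral_le_of_abs_le hC).const_mul _), integral_const_mul, integral_const_mul]

/-- The decisions to move are independent of the trajectory, so only the number of moves made
counts. -/
theorem integral_lazySteps {p : ℕ → ℝ≥0} (hp : ∀ i, p i ≤ 1) (μ₀ : ProbabilityMeasure P)
    (d : ℕ) {h : P → ℝ} (hm : Measurable h) (hC : ∀ x, |h x| ≤ C) :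
    ∫ x, lazySteps R p d h x ∂(μ₀ : Measure P) =
      ∫ k, (∫ x, h x ∂(chainLaw R μ₀ k : Measure P)) ∂poissonBinomial p d := by
  induction d generalizing h with
  | zero => simp [lazySteps, poissonBinomial, chainLaw]
  | succ d ih =>
    have hb : ∀ k, ‖∫ x, h x ∂(chainLaw R μ₀ k : Measure P)‖ ≤ C := fun k =>
      abs_integral_le_of_abs_le hC
    have := isProbabilityMeasure_poissonBinomial hp d
    have hint : ∀ u : ℕ → ℝ, (∀ k, ‖u k‖ ≤ C) → Integrable u (poissonBinomial p d) := fun u hu =>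
      integrable_of_abs_le measurable_from_top hu
    have hsucc : ∀ k, ∫ x, h x ∂(chainLaw R μ₀ (k + 1) : Measure P) =
        ∫ x, ∫ y, h y ∂(R x) ∂(chainLaw R μ₀ k : Measure P) := fun k =>
      integral_comp_measure hm hC
    rw [lazySteps, ih (measurable_lazyStep hm _) (abs_lazyStep_le hC (hp d)),
      integral_poissonBinomial_succ hp d hb]
    simp_rw [integral_lazyStep hm hC, ← hsucc]
    rw [integral_add ((hint _ hb).const_mul _) ((hint _ fun k => hb (k + 1)).const_mul _),
      integral_const_mul, integral_const_mul]
    rfl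

end Averaging

/-! ### Mean-square recursion for the urn -/

section SecondMoment

variable {P : Type*} [MeasurableSpace P]

theorem isProbabilityMeasure_nor {μ : FiniteMeasure P} (hμ : μ.mass ≠ 0) :
    IsProbabilityMeasure (nor μ) := by
  refine ⟨?_⟩
  rw [nor, Measure.smul_apply, smul_eq_mul, ← FiniteMeasure.ennreal_mass]
  exact ENNReal.inv_mul_cancel (by exact_mod_cast hμ) ENNReal.coe_ne_top

theorem integral_nor (μ : FiniteMeasure P) (h : P → ℝ) :
    ∫ x, h x ∂nor μ = (∫ x, h x ∂(μ : Measure P)) / μ.mass := by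
  rw [nor, integral_smul_measure, ← FiniteMeasure.ennreal_mass, ENNReal.toReal_inv,
    ENNReal.coe_toReal, smul_eq_mul, inv_mul_eq_div]

/-- The identity map, as a kernel from finite measures to points. -/
def compositionKernel (P : Type*) [MeasurableSpace P] : Kernel (FiniteMeasure P) P :=
  ⟨fun μ => (μ : Measure P), measurable_subtype_coe⟩

/-- The colour drawn, as a kernel from compositions to colours. -/
def norKernel (P : Type*) [MeasurableSpace P] : Kernel (FiniteMeasure P) P :=
  ⟨nor, Measure.measurable_of_measurable_coe _ fun s hs => by
    have h : ∀ t : Set P, MeasurableSet t → Measurable fun μ : FiniteMeasure P =>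
      (μ : Measure P) t := fun t ht => (compositionKernel P).measurable_coe ht
    simp only [nor, Measure.smul_apply, smul_eq_mul]
    exact (h univ MeasurableSet.univ).inv.mul (h s hs)⟩

instance : IsFiniteKernel (norKernel P) := by
  refine ⟨1, ENNReal.one_lt_top, fun μ => ?_⟩
  change nor μ univ ≤ 1
  rw [nor, Measure.smul_apply, smul_eq_mul]
  -- An inequality, because `nor 0 = 0`: in `ℝ≥0∞`, `0⁻¹ * 0 = 0`.
  exact ENNReal.inv_mul_le_one _

variable (R : Kernel P P) [IsMarkovKernel R]

theorem measurable_add_replacement :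
    Measurable fun q : FiniteMeasure P × P => q.1 + replacement R q.2 := by
  refine Measurable.subtype_mk (Measure.measurable_of_measurable_coe _ fun s hs => ?_)
  exact (((compositionKernel P).measurable_coe hs).comp measurable_fst).add
    ((R.measurable_coe hs).comp measurable_snd)

theorem measurable_add_replacement_left (μ : FiniteMeasure P) :
    Measurable fun c => μ + replacement R c :=
  (measurable_add_replacement R).comp measurable_prodMk_left

theorem measurable_stepLaw : Measurable (stepLaw R) := by
  refine Measure.measurable_of_measurable_coe _ fun A hA => ?_
  have h := Kernel.measurable_kernel_prodMk_left (κ := norKernel P)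
    (measurable_add_replacement R hA)
  convert! h using 2 with μ
  rw [stepLaw, Measure.map_apply (measurable_add_replacement_left R _) hA]
  rfl

variable {R} {Ω : Type*} [MeasurableSpace Ω] {Pr : Measure Ω}
  {M₀ : FiniteMeasure P} {M : ℕ → Ω → FiniteMeasure P}

theorem IsMVPP.measurable_stepLaw (hM : IsMVPP Pr M₀ R M) (n : ℕ) :
    Measurable fun ω => stepLaw R (M n ω) :=
  (MVPP.measurable_stepLaw R).comp (hM.measurable n)

theorem IsMVPP.map_succ (hM : IsMVPP Pr M₀ R M) (n : ℕ) :
    Pr.map (M (n + 1)) = Pr.bind fun ω => stepLaw R (M n ω) := by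
  ext A hA
  rw [Measure.map_apply (hM.measurable _) hA,
    Measure.bind_apply hA (hM.measurable_stepLaw n).aemeasurable]
  have h := hM.step n univ A MeasurableSet.univ hA
  simp only [mem_univ, true_and, ofPred_true, Measure.restrict_univ] at h
  exact h

theorem IsMVPP.lintegral_succ (hM : IsMVPP Pr M₀ R M) (n : ℕ) {G : FiniteMeasure P → ℝ≥0∞}
    (hG : Measurable G) :
    ∫⁻ ω, G (M (n + 1) ω) ∂Pr = ∫⁻ ω, ∫⁻ μ, G μ ∂stepLaw R (M n ω) ∂Pr := by
  rw [← lintegral_map hG (hM.measurable _), hM.map_succ,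
    Measure.lintegral_bind (hM.measurable_stepLaw n).aemeasurable
      hG.aemeasurable]

theorem lintegral_stepLaw (μ : FiniteMeasure P) {G : FiniteMeasure P → ℝ≥0∞}
    (hG : Measurable G) :
    ∫⁻ ν, G ν ∂stepLaw R μ = ∫⁻ c, G (μ + replacement R c) ∂nor μ :=
  lintegral_map hG (measurable_add_replacement_left R _)

theorem mass_add_replacement (μ : FiniteMeasure P) (c : P) :
    (μ + replacement R c).mass = μ.mass + 1 := by
  have h : (replacement R c).mass = 1 := by
    rw [← ENNReal.coe_inj, FiniteMeasure.ennreal_mass]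
    exact measure_univ (μ := R c)
  rw [← h]
  exact congrFun (FiniteMeasure.coeFn_add μ (replacement R c)) univ

theorem IsMVPP.ae_mass_eq (hM : IsMVPP Pr M₀ R M) (n : ℕ) :
    ∀ᵐ ω ∂Pr, (M n ω).mass = M₀.mass + n := by
  induction n with
  | zero => filter_upwards [hM.initial] with ω hω; simp [hω]
  | succ n ih =>
    have hA : MeasurableSet {μ : FiniteMeasure P | μ.mass ≠ M₀.mass + (n + 1 : ℕ)} := by
      have hmass : Measurable fun μ : FiniteMeasure P => μ.mass :=
        ((compositionKernel P).measurable_coe MeasurableSet.univ).ennreal_toNNReal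
      exact (measurableSet_eq_fun hmass measurable_const).compl
    have hmap : Pr.map (M (n + 1)) {μ | μ.mass ≠ M₀.mass + (n + 1 : ℕ)} = 0 := by
      rw [hM.map_succ, Measure.bind_apply hA
        (hM.measurable_stepLaw n).aemeasurable,
        lintegral_eq_zero_iff ((Measure.measurable_coe hA).fun_comp (hM.measurable_stepLaw n))]
      filter_upwards [ih] with ω hω
      rw [stepLaw, Measure.map_apply
        (measurable_add_replacement_left R _) hA]
      simp only [preimage_ofPred_eq, mass_add_replacement, hω]
      push_cast
      simp [add_assoc]
    rwa [Measure.map_apply (hM.measurable _) hA] at hmap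

/-- The excess over the squared mean is `s²` times the variance of `u`, itself at most `C²`. -/
theorem integral_add_mul_sq_le {μ : Measure P} [IsProbabilityMeasure μ] {u : P → ℝ} {C : ℝ}
    (hm : Measurable u) (hC : ∀ x, |u x| ≤ C) (r s : ℝ) :
    ∫ x, (r + s * u x) ^ 2 ∂μ ≤ (r + s * ∫ x, u x ∂μ) ^ 2 + s ^ 2 * C ^ 2 := by
  have hsq : ∀ x, u x ^ 2 ≤ C ^ 2 := fun x => sq_le_sq' (neg_le_of_abs_le (hC x))
    (le_of_abs_le (hC x))
  have hi : Integrable u μ := integrable_of_abs_le hm hC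
  have hi2 : Integrable (fun x => u x ^ 2) μ :=
    integrable_of_abs_le (hm.pow_const 2) fun x => by rw [abs_of_nonneg (sq_nonneg _)]; exact hsq x
  have h2 : ∫ x, u x ^ 2 ∂μ ≤ C ^ 2 := by
    simpa using integral_mono hi2 (integrable_const (C ^ 2)) hsq
  have he : ∫ x, (r + s * u x) ^ 2 ∂μ =
      r ^ 2 + 2 * r * s * ∫ x, u x ∂μ + s ^ 2 * ∫ x, u x ^ 2 ∂μ := by
    have : ∀ x, (r + s * u x) ^ 2 = r ^ 2 + 2 * r * s * u x + s ^ 2 * u x ^ 2 := fun x => by ring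
    simp_rw [this]
    have hlin : Integrable (fun x => r ^ 2 + 2 * r * s * u x) μ :=
      (integrable_const _).add (hi.const_mul _)
    rw [integral_add hlin (hi2.const_mul _),
      integral_add (integrable_const _) (hi.const_mul _), integral_const_mul, integral_const_mul]
    simp
  rw [he]
  nlinarith [mul_le_mul_of_nonneg_left h2 (sq_nonneg s), sq_nonneg (s * ∫ x, u x ∂μ)]

/-- With `p = 1 / (m + 1)` one has `(1 - p) / m = 1 / (m + 1)`, so the mean of the new normalised
integral is exactly a lazy step averaged over the old composition; the added term bounds the
variance. Keeping `c` arbitrary lets the estimate be iterated without conditional expectations. -/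
theorem lintegral_stepLaw_sq_le {μ : FiniteMeasure P} {m : ℝ≥0} (hμ : μ.mass = m) (hm0 : 0 < m)
    {h : P → ℝ} (hm : Measurable h) {C : ℝ} (hC : ∀ x, |h x| ≤ C) (c : ℝ) :
    ∫⁻ ν, ENNReal.ofReal (((∫ x, h x ∂(ν : Measure P)) / (m + 1) - c) ^ 2) ∂stepLaw R μ ≤
      ENNReal.ofReal (((∫ x, lazyStep R (m + 1)⁻¹ h x ∂(μ : Measure P)) / m - c) ^ 2) +
        ENNReal.ofReal (C ^ 2 * ((m + 1 : ℝ)⁻¹) ^ 2) := by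
  have := isProbabilityMeasure_nor (μ := μ) (by rw [hμ]; exact hm0.ne')
  have hm0' : (0 : ℝ) < m := hm0
  have hu := measurable_integral_kernel R hm
  have huC : ∀ x, |∫ y, h y ∂(R x)| ≤ C := fun x => abs_integral_le_of_abs_le hC
  have hint : ∀ ν : FiniteMeasure P, Integrable h (ν : Measure P) := fun ν =>
    integrable_of_abs_le hm hC
  set r : ℝ := (∫ x, h x ∂(μ : Measure P)) / (m + 1) - c with hr
  set s : ℝ := (m + 1 : ℝ)⁻¹ with hs
  have hG : Measurable fun ν : FiniteMeasure P =>
      ENNReal.ofReal (((∫ x, h x ∂(ν : Measure P)) / (m + 1) - c) ^ 2) :=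
    ((((measurable_integral_kernel (compositionKernel P) hm).div_const _).sub_const _).pow_const
      2).ennreal_ofReal
  have e1 : ∀ y, (∫ x, h x ∂((μ + replacement R y : FiniteMeasure P) : Measure P)) / (m + 1) - c =
      r + s * ∫ x, h x ∂(R y) := fun y => by
    rw [FiniteMeasure.toMeasure_add, integral_add_measure (hint _) (hint _), hr, hs]
    change (_ + ∫ x, h x ∂(R y)) / _ - _ = _
    ring
  have e2 : (∫ x, lazyStep R (m + 1)⁻¹ h x ∂(μ : Measure P)) / m - c =
      r + s * ∫ x, ∫ y, h y ∂(R x) ∂nor μ := by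
    have h1 := integral_nor μ (lazyStep R (m + 1)⁻¹ h)
    rw [hμ] at h1
    rw [← h1, integral_lazyStep hm hC, integral_nor μ h, hμ, hr, hs]
    push_cast
    field_simp
    ring
  rw [lintegral_stepLaw _ hG, e2, ← ENNReal.ofReal_add (sq_nonneg _) (by positivity)]
  simp_rw [e1]
  have hb : ∀ y, |(r + s * ∫ x, h x ∂(R y)) ^ 2| ≤ (|r| + |s| * C) ^ 2 := fun y => by
    rw [abs_pow]
    refine pow_le_pow_left₀ (abs_nonneg _) ((abs_add_le _ _).trans ?_) 2
    rw [abs_mul]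
    gcongr
    exact huC y
  rw [← ofReal_integral_eq_lintegral_ofReal
    (integrable_of_abs_le (((hu.const_mul s).const_add r).pow_const 2) hb)
    (ae_of_all _ fun y => sq_nonneg _)]
  refine ENNReal.ofReal_le_ofReal ((integral_add_mul_sq_le hu huC r s).trans_eq ?_)
  ring

theorem IsMVPP.lintegral_sq_succ_le (hM : IsMVPP Pr M₀ R M) [IsProbabilityMeasure Pr]
    (hM₀ : 0 < M₀.mass) (n : ℕ)
    {h : P → ℝ} (hm : Measurable h) {C : ℝ} (hC : ∀ x, |h x| ≤ C) (c : ℝ) :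
    ∫⁻ ω, ENNReal.ofReal (((∫ x, h x ∂(M (n + 1) ω : Measure P)) / (M₀.mass + n + 1) - c) ^ 2)
        ∂Pr ≤
      ∫⁻ ω, ENNReal.ofReal (((∫ x, lazyStep R (M₀.mass + n + 1)⁻¹ h x ∂(M n ω : Measure P)) /
        (M₀.mass + n) - c) ^ 2) ∂Pr +
        ENNReal.ofReal (C ^ 2 * ((M₀.mass + n + 1 : ℝ)⁻¹) ^ 2) := by
  have hG : Measurable fun ν : FiniteMeasure P =>
      ENNReal.ofReal (((∫ x, h x ∂(ν : Measure P)) / (M₀.mass + n + 1) - c) ^ 2) :=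
    ((((measurable_integral_kernel (compositionKernel P) hm).div_const _).sub_const _).pow_const
      2).ennreal_ofReal
  rw [hM.lintegral_succ n hG]
  refine (lintegral_mono_ae (g := fun ω => ENNReal.ofReal
    (((∫ x, lazyStep R (M₀.mass + n + 1)⁻¹ h x ∂(M n ω : Measure P)) / (M₀.mass + n) - c) ^ 2) +
      ENNReal.ofReal (C ^ 2 * ((M₀.mass + n + 1 : ℝ)⁻¹) ^ 2)) ?_).trans_eq ?_
  · filter_upwards [hM.ae_mass_eq n] with ω hω
    have := lintegral_stepLaw_sq_le (R := R) hω (by positivity) hm hC c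
    push_cast at this
    exact this
  · rw [lintegral_add_right _ measurable_const, lintegral_const, measure_univ, mul_one]

theorem IsMVPP.lintegral_sq_add_le (hM : IsMVPP Pr M₀ R M) [IsProbabilityMeasure Pr]
    (hM₀ : 0 < M₀.mass) (j d : ℕ)
    {h : P → ℝ} (hm : Measurable h) {C : ℝ} (hC : ∀ x, |h x| ≤ C) (c : ℝ) :
    ∫⁻ ω, ENNReal.ofReal (((∫ x, h x ∂(M (j + d) ω : Measure P)) / (M₀.mass + (j + d : ℕ)) - c) ^ 2)
        ∂Pr ≤
      ∫⁻ ω, ENNReal.ofReal (((∫ x, lazySteps R (fun i => (M₀.mass + j + i + 1)⁻¹) d h x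
        ∂(M j ω : Measure P)) / (M₀.mass + j) - c) ^ 2) ∂Pr +
        ENNReal.ofReal (C ^ 2 * ∑ i ∈ Finset.range d, ((M₀.mass + j + i + 1 : ℝ)⁻¹) ^ 2) := by
  induction d generalizing h with
  | zero => simp [lazySteps]
  | succ d ih =>
    have h1 := hM.lintegral_sq_succ_le hM₀ (j + d) hm hC c
    -- The last draw has been absorbed into the test function, which keeps the same bound `C`.
    have h2 := ih (measurable_lazyStep (R := R) hm (M₀.mass + j + d + 1)⁻¹)
      (abs_lazyStep_le hC (inv_le_one_of_one_le₀ le_add_self))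
    rw [Finset.sum_range_succ, mul_add, ENNReal.ofReal_add (by positivity) (by positivity),
      ← add_assoc]
    push_cast [← add_assoc] at h1 h2 ⊢
    exact h1.trans (by gcongr; exact h2)

end SecondMoment

/-! ### Reduction of weak convergence in probability to test functions -/

section ConvergenceInProbability

variable {Ω E : Type*} [MeasurableSpace Ω] {Pr : Measure Ω}

theorem nhds_eq_iInf_comap_integral {P : Type*} [TopologicalSpace P] [MeasurableSpace P]
    [OpensMeasurableSpace P] (ν : FiniteMeasure P) :
    𝓝 ν = ⨅ φ : BoundedContinuousFunction P ℝ, comap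
      (fun μ : FiniteMeasure P => ∫ x, φ x ∂(μ : Measure P)) (𝓝 (∫ x, φ x ∂(ν : Measure P))) := by
  refine le_antisymm (le_iInf fun φ => tendsto_iff_comap.1
    (FiniteMeasure.tendsto_iff_forall_integral_tendsto.1 tendsto_id φ)) ?_
  exact FiniteMeasure.tendsto_iff_forall_integral_tendsto.2 fun φ =>
    tendsto_iff_comap.2 (iInf_le _ φ)

/-- The filter of the sets which the sequence `X` hits with probability tending to one. -/
def asymptoticallySureFilter (Pr : Measure Ω) (X : ℕ → Ω → E) : Filter E where
  sets := {U | Tendsto (fun n => Pr {ω | X n ω ∉ U}) atTop (𝓝 0)}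
  univ_sets := by simp
  sets_of_superset hU hUV := tendsto_of_tendsto_of_tendsto_of_le_of_le tendsto_const_nhds hU
    (fun _ => zero_le) fun _ => measure_mono fun _ hω h => hω (hUV h)
  inter_sets {U V} hU hV := by
    have h : Tendsto (fun n => Pr {ω | X n ω ∉ U} + Pr {ω | X n ω ∉ V}) atTop (𝓝 0) := by
      simpa using Tendsto.add hU hV
    refine tendsto_of_tendsto_of_tendsto_of_le_of_le tendsto_const_nhds h
      (fun _ => zero_le) fun n => (measure_mono fun ω hω => ?_).trans (measure_union_le _ _)
    by_contra hn
    simp only [mem_union, mem_ofPred_eq, not_or, not_not] at hn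
    exact hω hn

/-- In this order form, a neighbourhood filter that is an infimum over test functions can be treated
one test function at a time. -/
theorem tendstoInProbability_iff_le [TopologicalSpace E] {X : ℕ → Ω → E} {l : E} :
    TendstoInProbability Pr X l ↔ asymptoticallySureFilter Pr X ≤ 𝓝 l :=
  Iff.rfl

theorem tendstoInProbability_of_forall_integral {P : Type*} [TopologicalSpace P]
    [MeasurableSpace P] [OpensMeasurableSpace P] {X : ℕ → Ω → FiniteMeasure P}
    {ν : FiniteMeasure P}
    (h : ∀ φ : BoundedContinuousFunction P ℝ, ∀ δ > 0, Tendsto (fun n => Pr {ω |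
      δ ≤ |∫ x, φ x ∂(X n ω : Measure P) - ∫ x, φ x ∂(ν : Measure P)|}) atTop (𝓝 0)) :
    TendstoInProbability Pr X ν := by
  rw [tendstoInProbability_iff_le, nhds_eq_iInf_comap_integral]
  refine le_iInf fun φ => tendsto_iff_comap.1 (Metric.nhds_basis_ball.tendsto_right_iff.2
    fun δ hδ => ?_)
  refine (h φ δ hδ).congr fun n => congrArg Pr ?_
  ext ω
  simp [Real.dist_eq]

theorem tendsto_measure_of_tendsto_lintegral_sq {Z : ℕ → Ω → ℝ}
    (h : Tendsto (fun n => ∫⁻ ω, ENNReal.ofReal (Z n ω ^ 2) ∂Pr) atTop (𝓝 0))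
    (hZ : ∀ n, Measurable (Z n)) {δ : ℝ} (hδ : 0 < δ) :
    Tendsto (fun n => Pr {ω | δ ≤ |Z n ω|}) atTop (𝓝 0) := by
  have hδ2 : ENNReal.ofReal (δ ^ 2) ≠ 0 := (ENNReal.ofReal_pos.2 (by positivity)).ne'
  have h' : Tendsto (fun n => (∫⁻ ω, ENNReal.ofReal (Z n ω ^ 2) ∂Pr) / ENNReal.ofReal (δ ^ 2))
      atTop (𝓝 0) := by
    simpa using ENNReal.Tendsto.div_const h (Or.inr hδ2)
  refine tendsto_of_tendsto_of_tendsto_of_le_of_le tendsto_const_nhds h' (fun _ => zero_le)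
    fun n => (measure_mono fun ω hω => ?_).trans
      (meas_ge_le_lintegral_div ((hZ n).pow_const 2).ennreal_ofReal.aemeasurable hδ2
        ENNReal.ofReal_ne_top)
  refine ENNReal.ofReal_le_ofReal ?_
  rw [← sq_abs (Z n ω)]
  exact pow_le_pow_left₀ hδ.le hω 2

end ConvergenceInProbability

/-! ### Mean-square convergence and conclusion -/

section Main

theorem integral_theta_smul {P B K : Type*} [TopologicalSpace P] [MeasurableSpace P]
    [BorelSpace P] [AddCommGroup B] [TopologicalSpace B] [AddAction B P] [ContinuousVAdd B P]
    [CommMonoid K] [TopologicalSpace K] [MulAction K P] [ContinuousSMul K P] (a : Kˣ) (b : B) (r : ℝ≥0) (μ : FiniteMeasure P)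
    (φ : BoundedContinuousFunction P ℝ) :
    ∫ w, φ w ∂(theta a b (r • μ) : Measure P) =
      r * ∫ w, φ (a⁻¹ • (-b +ᵥ w)) ∂(μ : Measure P) := by
  rw [theta, FiniteMeasure.toMeasure_map,
    integral_map (continuous_normalization a b).measurable.aemeasurable
      φ.continuous.measurable.aestronglyMeasurable, FiniteMeasure.toMeasure_smul,
    integral_smul_nnreal_measure]
  rfl

variable {P : Type*} [TopologicalSpace P] [PolishSpace P] [MeasurableSpace P] [BorelSpace P]
  {B : Type*} [AddCommGroup B] [TopologicalSpace B] [AddAction B P] [ContinuousVAdd B P]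
  [MeasurableSpace B] [BorelSpace B]
  {K : Type*} [CommMonoid K] [TopologicalSpace K] [MulAction K P] [ContinuousSMul K P]
  [MeasurableSpace K] [BorelSpace K] [DistribMulAction K B]

/-- The conditional expectations given the composition at a fixed time `j` converge. -/
theorem tendsto_integral_lazySteps
    (smul_vadd : ∀ (k : K) (c : B) (x : P), k • (c +ᵥ x) = (k • c) +ᵥ (k • x))
    {R : Kernel P P} [IsMarkovKernel R] {a : ℝ → Kˣ} {b : ℝ → B} {γ : ProbabilityMeasure P}
    (ergodic : IsErgodic R (fun n : ℕ => a n) (fun n : ℕ => b n) γ)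
    {f : ℝ → B} {g : ℝ → K} (hf : Measurable f) (hg : Measurable g)
    (regular : ∀ᵐ x : ℝ, ∀ ε : ℝ → ℝ, ε =o[atTop] (fun t : ℝ => √t) →
      Tendsto (fun t : ℝ => (a t)⁻¹ • (b (⌊t + x * √t + ε t⌋₊ : ℕ) - b t)) atTop (𝓝 (f x)) ∧
      Tendsto (fun t : ℝ => ((a (⌊t + x * √t + ε t⌋₊ : ℕ) / a t : Kˣ) : K)) atTop (𝓝 (g x)))
    (φ : BoundedContinuousFunction P ℝ) {μ : FiniteMeasure P} {m : ℝ≥0} (hμ : μ.mass = m)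
    (hm : 0 < m) (j : ℕ) :
    Tendsto (fun n : ℕ => (∫ x, lazySteps R (fun i => (m + i + 1)⁻¹) (n - j)
        (fun w => φ ((a (Real.log n))⁻¹ • (-(b (Real.log n)) +ᵥ w))) x ∂(μ : Measure P)) / m)
      atTop (𝓝 (∫ w, φ w ∂(limitLaw γ f g : Measure P))) := by
  have hm' : (0 : ℝ) < m := hm
  have hp : ∀ i : ℕ, (m + i + 1)⁻¹ ≤ 1 := fun i => inv_le_one_of_one_le₀ le_add_self
  -- The chain starts from the normalised composition, which is arbitrary; ergodicity makes the
  -- limit independent of it.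
  let μ₀ : ProbabilityMeasure P :=
    ⟨nor μ, isProbabilityMeasure_nor (by rw [hμ]; exact hm.ne')⟩
  refine (tendsto_integral_poissonBinomial_chainLaw smul_vadd ergodic hf hg regular
    μ₀ φ (p := fun i => (m + i + 1)⁻¹) hp (D := (m : ℝ)⁻¹)
    (d := fun n => n - j) (C := Real.log (m + 1) + Real.log (j + 1) + |Real.log m|)
    (fun d => ?_) ?_).congr fun n => ?_
  · push_cast
    exact (sum_inv_sq_le hm' d).trans (sub_le_self _ (by positivity))
  · filter_upwards [eventually_ge_atTop 1] with n hn
    push_cast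
    exact abs_sum_inv_sub_log_le hm' j hn
  · have hφ : Measurable fun w => φ ((a (Real.log n))⁻¹ • (-(b (Real.log n)) +ᵥ w)) :=
      (φ.continuous.comp (continuous_normalization _ _)).measurable
    refine (integral_lazySteps hp μ₀ (n - j) hφ fun x => φ.norm_coe_le_norm _).symm.trans ?_
    rw [← hμ]
    exact integral_nor μ _

theorem IsMVPP.tendsto_lintegral_sq
    (smul_vadd : ∀ (k : K) (c : B) (x : P), k • (c +ᵥ x) = (k • c) +ᵥ (k • x))
    {R : Kernel P P} [IsMarkovKernel R] {a : ℝ → Kˣ} {b : ℝ → B} {γ : ProbabilityMeasure P}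
    (ergodic : IsErgodic R (fun n : ℕ => a n) (fun n : ℕ => b n) γ)
    {f : ℝ → B} {g : ℝ → K} (hf : Measurable f) (hg : Measurable g)
    (regular : ∀ᵐ x : ℝ, ∀ ε : ℝ → ℝ, ε =o[atTop] (fun t : ℝ => √t) →
      Tendsto (fun t : ℝ => (a t)⁻¹ • (b (⌊t + x * √t + ε t⌋₊ : ℕ) - b t)) atTop (𝓝 (f x)) ∧
      Tendsto (fun t : ℝ => ((a (⌊t + x * √t + ε t⌋₊ : ℕ) / a t : Kˣ) : K)) atTop (𝓝 (g x)))
    {Ω : Type*} [MeasurableSpace Ω] {Pr : Measure Ω} [IsProbabilityMeasure Pr]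
    {M₀ : FiniteMeasure P} (hM₀ : 0 < M₀.mass)
    {M : ℕ → Ω → FiniteMeasure P} (hM : IsMVPP Pr M₀ R M)
    (φ : BoundedContinuousFunction P ℝ) :
    Tendsto (fun n : ℕ => ∫⁻ ω, ENNReal.ofReal
      (((∫ w, φ ((a (Real.log n))⁻¹ • (-(b (Real.log n)) +ᵥ w)) ∂(M n ω : Measure P)) /
        (M₀.mass + n) - ∫ w, φ w ∂(limitLaw γ f g : Measure P)) ^ 2) ∂Pr) atTop (𝓝 0) := by
  set c := ∫ w, φ w ∂(limitLaw γ f g : Measure P)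
  let h : ℕ → P → ℝ := fun n w => φ ((a (Real.log n))⁻¹ • (-(b (Real.log n)) +ᵥ w))
  have hm : ∀ n, Measurable (h n) := fun n =>
    (φ.continuous.comp (continuous_normalization _ _)).measurable
  have hC : ∀ n x, |h n x| ≤ ‖φ‖ := fun n x => φ.norm_coe_le_norm _
  have hM₀' : (0 : ℝ) < M₀.mass := hM₀
  have hpast : ∀ j : ℕ, Tendsto (fun n : ℕ => ∫⁻ ω, ENNReal.ofReal
      (((∫ x, lazySteps R (fun i => (M₀.mass + j + i + 1)⁻¹) (n - j) (h n) x
        ∂(M j ω : Measure P)) / (M₀.mass + j) - c) ^ 2) ∂Pr) atTop (𝓝 0) := by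
    intro j
    have hp : ∀ i : ℕ, (M₀.mass + j + i + 1)⁻¹ ≤ 1 := fun i => inv_le_one_of_one_le₀ le_add_self
    have hlim := tendsto_lintegral_of_dominated_convergence (μ := Pr)
      (F := fun n ω => ENNReal.ofReal
        (((∫ x, lazySteps R (fun i => (M₀.mass + j + i + 1)⁻¹) (n - j) (h n) x
          ∂(M j ω : Measure P)) / (M₀.mass + j) - c) ^ 2)) (f := fun _ => 0)
      (fun _ => ENNReal.ofReal ((‖φ‖ + |c|) ^ 2)) (fun n => ?_) (fun n => ?_) ?_ ?_
    · simpa using hlim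
    · exact (((((measurable_integral_kernel (compositionKernel P)
        (measurable_lazySteps _ _ (hm n))).comp (hM.measurable j)).div_const _).sub_const _).pow_const
          2).ennreal_ofReal
    · filter_upwards [hM.ae_mass_eq j] with ω hω
      have hpos : 0 < M₀.mass + j := by positivity
      have := isProbabilityMeasure_nor (μ := M j ω) (by rw [hω]; exact hpos.ne')
      have hnor := integral_nor (M j ω)
        (lazySteps R (fun i => (M₀.mass + j + i + 1)⁻¹) (n - j) (h n))
      rw [hω] at hnor
      push_cast at hnor
      refine ENNReal.ofReal_le_ofReal ?_
      rw [← hnor, ← sq_abs]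
      refine pow_le_pow_left₀ (abs_nonneg _) ((abs_sub _ _).trans ?_) 2
      gcongr
      exact abs_integral_le_of_abs_le (abs_lazySteps_le hp _ (hC n))
    · simp
    · filter_upwards [hM.ae_mass_eq j] with ω hω
      have hpos : 0 < M₀.mass + j := by positivity
      have hlim := tendsto_integral_lazySteps smul_vadd ergodic hf hg regular φ hω hpos j
      push_cast at hlim
      have := ((hlim.sub_const c).pow 2)
      rw [sub_self, zero_pow two_ne_zero] at this
      simpa using ENNReal.tendsto_ofReal this
  have hbound : ∀ j n : ℕ, j ≤ n → ∫⁻ ω, ENNReal.ofReal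
      (((∫ w, h n w ∂(M n ω : Measure P)) / (M₀.mass + n) - c) ^ 2) ∂Pr ≤
      ∫⁻ ω, ENNReal.ofReal (((∫ x, lazySteps R (fun i => (M₀.mass + j + i + 1)⁻¹) (n - j) (h n) x
        ∂(M j ω : Measure P)) / (M₀.mass + j) - c) ^ 2) ∂Pr +
      ENNReal.ofReal (‖φ‖ ^ 2 * (M₀.mass + j : ℝ)⁻¹) := by
    intro j n hjn
    have h1 := hM.lintegral_sq_add_le hM₀ j (n - j) (hm n) (hC n) c
    rw [Nat.add_sub_cancel' hjn] at h1
    refine h1.trans (add_le_add le_rfl (ENNReal.ofReal_le_ofReal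
      (mul_le_mul_of_nonneg_left ?_ (sq_nonneg _))))
    exact (sum_inv_sq_le (m := M₀.mass + j) (by positivity) _).trans
      (sub_le_self _ (by positivity))
  have htail : Tendsto (fun j : ℕ => ENNReal.ofReal (‖φ‖ ^ 2 * (M₀.mass + j : ℝ)⁻¹)) atTop
      (𝓝 0) := by
    have h1 : Tendsto (fun j : ℕ => (M₀.mass : ℝ) + j) atTop atTop :=
      tendsto_atTop_add_const_left _ _ tendsto_natCast_atTop_atTop
    have h2 := ENNReal.tendsto_ofReal (h1.inv_tendsto_atTop.const_mul (‖φ‖ ^ 2))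
    rw [mul_zero, ENNReal.ofReal_zero] at h2
    exact h2
  refine ENNReal.tendsto_nhds_zero.2 fun δ hδ => ?_
  have hδ2 : 0 < δ / 2 := ENNReal.half_pos hδ.ne'
  -- First `j` is fixed to make the later fluctuations small uniformly in `n`; then `n → ∞`.
  obtain ⟨j, hj⟩ := (ENNReal.tendsto_nhds_zero.1 htail (δ / 2) hδ2).exists
  filter_upwards [ENNReal.tendsto_nhds_zero.1 (hpast j) (δ / 2) hδ2, eventually_ge_atTop j]
    with n hn hjn
  calc _ ≤ _ := hbound j n hjn
    _ ≤ δ / 2 + δ / 2 := add_le_add hn hj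
    _ = δ := ENNReal.add_halves δ

end Main

end MVPP

end

theorem theorem1
    -- the Polish space of colours
    {P : Type*} [TopologicalSpace P] [PolishSpace P] [MeasurableSpace P] [BorelSpace P]
    -- the group of shifts, acting on colours by `b +ᵥ x`
    {B : Type*} [AddCommGroup B] [TopologicalSpace B] [TopologicalSpace.MetrizableSpace B]
    [SecondCountableTopology B] [MeasurableSpace B] [BorelSpace B]
    [AddAction B P] [ContinuousVAdd B P]
    -- the scalars, acting on colours by `k • x`
    {K : Type*} [CommMonoid K] [TopologicalSpace K] [TopologicalSpace.MetrizableSpace K]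
    [SecondCountableTopology K] [MeasurableSpace K] [BorelSpace K]
    [MulAction K P] [ContinuousSMul K P] [DistribMulAction K B]
    (smul_vadd : ∀ (k : K) (c : B) (x : P), k • (c +ᵥ x) = (k • c) +ᵥ (k • x))
    -- the replacement kernel, satisfying the balance hypothesis `R x univ = 1`
    (R : Kernel P P) [IsMarkovKernel R]
    -- the normalisations
    (a : ℝ → Kˣ) (b : ℝ → B) (γ : ProbabilityMeasure P)
    (ergodic : MVPP.IsErgodic R (fun n : ℕ => a n) (fun n : ℕ => b n) γ)
    (f : ℝ → B) (g : ℝ → K) (hf : Measurable f) (hg : Measurable g)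
    (regular : ∀ᵐ x : ℝ, ∀ ε : ℝ → ℝ, ε =o[atTop] (fun t : ℝ => √t) →
      Tendsto (fun t : ℝ => (a t)⁻¹ • (b (⌊t + x * √t + ε t⌋₊ : ℕ) - b t)) atTop (𝓝 (f x)) ∧
      Tendsto (fun t : ℝ => ((a (⌊t + x * √t + ε t⌋₊ : ℕ) / a t : Kˣ) : K)) atTop (𝓝 (g x)))
    -- the process, for an arbitrary finite nonzero initial composition
    {Ω : Type*} [MeasurableSpace Ω] (Pr : Measure Ω) [IsProbabilityMeasure Pr]
    (M₀ : FiniteMeasure P) (hM₀ : M₀ ≠ 0)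
    (M : ℕ → Ω → FiniteMeasure P) (hM : MVPP.IsMVPP Pr M₀ R M) :
    MVPP.TendstoInProbability Pr
      (fun n ω => MVPP.theta (a (Real.log n)) (b (Real.log n)) ((n : ℝ≥0)⁻¹ • M n ω))
      (MVPP.limitLaw γ f g) := by
  have hmass : 0 < M₀.mass := pos_iff_ne_zero.2 ((FiniteMeasure.mass_nonzero_iff M₀).2 hM₀)
  refine MVPP.tendstoInProbability_of_forall_integral fun φ δ hδ => ?_
  have hsq := hM.tendsto_lintegral_sq smul_vadd ergodic hf hg regular hmass φ
  set c := ∫ w, φ w ∂(MVPP.limitLaw γ f g : Measure P)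
  have hprob := MVPP.tendsto_measure_of_tendsto_lintegral_sq hsq (fun n =>
    ((((MVPP.measurable_integral_kernel (MVPP.compositionKernel P)
      (φ.continuous.comp (MVPP.continuous_normalization (a (Real.log n))
        (b (Real.log n)))).measurable).comp (hM.measurable n)).div_const _).sub_const _))
    -- Normalising by `n` instead of the mass `M₀.mass + n` multiplies the error by a ratio below
    -- `2` and adds a shift below `δ / 2`; `2 * (δ / 4) + δ / 2 = δ`.
    (δ := δ / 4) (by positivity)
  have hratio : Tendsto (fun n : ℕ => ((M₀.mass : ℝ) + n) / n) atTop (𝓝 1) := by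
    have h1 : Tendsto (fun n : ℕ => (M₀.mass : ℝ) / n + 1) atTop (𝓝 1) := by
      simpa using (tendsto_const_div_atTop_nhds_zero_nat (M₀.mass : ℝ)).add_const 1
    refine h1.congr' ?_
    filter_upwards [eventually_gt_atTop 0] with n hn
    have : (n : ℝ) ≠ 0 := by positivity
    rw [add_div, div_self this]
  have hshift : Tendsto (fun n : ℕ => |c| * |((M₀.mass : ℝ) + n) / n - 1|) atTop (𝓝 0) := by
    simpa using ((hratio.sub_const 1).abs).const_mul |c|
  refine tendsto_of_tendsto_of_tendsto_of_le_of_le' tendsto_const_nhds hprob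
    (Eventually.of_forall fun _ => zero_le) ?_
  filter_upwards [eventually_gt_atTop 0, hratio.eventually (gt_mem_nhds one_lt_two),
    hshift.eventually (gt_mem_nhds (half_pos hδ))] with n hn hr hs
  refine measure_mono fun ω hω => ?_
  have hn' : (0 : ℝ) < n := by exact_mod_cast hn
  have hpos : (0 : ℝ) < M₀.mass + n := by positivity
  simp only [mem_ofPred_eq, MVPP.integral_theta_smul] at hω ⊢
  set I := ∫ w, φ ((a (Real.log n))⁻¹ • (-(b (Real.log n)) +ᵥ w)) ∂(M n ω : Measure P)
  set r := ((M₀.mass : ℝ) + n) / n with hr_def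
  have hr0 : 0 ≤ r := by positivity
  have he : ((n : ℝ≥0)⁻¹ : ℝ≥0) * I - c = r * (I / (M₀.mass + n) - c) + c * (r - 1) := by
    rw [hr_def]
    push_cast
    field_simp
    ring
  rw [he] at hω
  have h1 := hω.trans (abs_add_le _ _)
  rw [abs_mul, abs_mul, abs_of_nonneg hr0] at h1
  by_contra hlt
  push Not at hlt
  have h2 : r * |I / (M₀.mass + n) - c| ≤ 2 * (δ / 4) :=
    mul_le_mul hr.le hlt.le (abs_nonneg _) two_pos.le
  linarith
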